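/- Let $T_1\le T_2\le\cdots$ be claim arrival times, $T_0=0$, with inter-claim times $V_i=T_i-T_{i-1}$, let $N(t)=\max\{n\ge 0: T_n\le t\}$ be the number of claims up to and including time $t\ge 0$, let $X_1,X_2,\dots$ be real claim sizes, and let $S(t)=\sum_{i=1}^{N(t)}X_i$. For $\lambda\ge 0$, a homogeneous Poisson process $N_\lambda$ with rate $\lambda$ is one whose inter-claim times are independent and exponentially distributed with rate $\lambda$ (infinite if $\lambda=0$), so that $N_\lambda(s)$ has the Poisson distribution with mean $\lambda s$. Assume that $N$ is a mixed Poisson process with structure cdf $L$ on $[0,\infty)$, that is, its law is the mixture of the laws of the processes $N_\lambda$ with respect to $dL(\lambda)$ (if $L$ has an atom at $0$, then all $T_i$ and $V_i$, $i\ge1$, are set equal to $\infty$ when there are no claims). Assume that each $X_i$ depends on the arrival process only via $V_i$ (the conditional distribution of $X_i$ given $(V_k)_{k\ge1}$ equals that given $V_i$) and that the $X_i$ are conditionally independent given $(V_k)_{k\ge 1}$. Put $$\Delta_i(v)=\mathbf E[X_i\mid V_i=v],\quad \Theta_i(v)=\mathbf E[X_i^2\mid V_i=v],\quad \Theta(n|v)=\sum_{i=1}^n\Theta_i(v),\quad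 \Upsilon(n|y,v)=\sum_{1\le i\ne j\le n}\Delta_i(y)\Delta_j(v).$$ Then $$\mathbf E[S^2(t)]=\int_0^\infty\!\!\int_0^t\lambda e^{-\lambda v}\,\mathbf E\big[\Theta(N_\lambda(t-v)+1\,|\,v)\big]\,dv\,dL(\lambda)+\int_0^\infty\!\!\int_0^t\!\!\int_0^{t-y}\lambda^2e^{-\lambda(y+v)}\,\mathbf E\big[\Upsilon(N_\lambda(t-y-v)+2\,|\,y,v)\big]\,dv\,dy\,dL(\lambda)$$ in the following two cases. (1) If all $X_i\ge 0$ almost surely, the identity holds in $[0,\infty]$ (with $0\cdot\infty=0$). (2) If the $X_i$ are of arbitrary sign and $\mathbf E\big[\big(\sum_{i=1}^{N(t)}|X_i|\big)^2\big]<\infty$, the identity holds between real numbers, and everything in it exists: $S^2(t)$ is integrable; for $L$-almost every $\lambda>0$, the conditional means and second moments exist for almost every $v\in(0,t)$, $\Theta(N_\lambda(t-v)+1|v)$ is integrable for almost every $v\in(0,t)$, and $\Upsilon(N_\lambda(t-y-v)+2|y,v)$ is integrable for almost every $y\in(0,t)$ and almost every $v\in(0,t-y)$; and the two integrands on the right are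 integrable in $(\lambda,v)$ and in $(\lambda,y,v)$ respectively. -/

import Mathlib

open MeasureTheory ProbabilityTheory
open scoped ENNReal NNReal

namespace AggregateClaims

noncomputable section

variable {Ω : Type*} [MeasurableSpace Ω]

/-!
Claims are numbered from `0`: `V i`, `X i` are the inter-claim time and the size of the
`(i+1)`-st claim. Times take values in `[0, ∞]`; the value `∞` means that the claim never
arrives (this happens with positive probability only if the structure distribution charges `0`).
-/

/-- The arrival time `T n = V 0 + ⋯ + V (n-1)` of the `n`-th claim, with `T 0 = 0`. -/
def arrivalTime (V : ℕ → Ω → ℝ≥0∞) (n : ℕ) (ω : Ω) : ℝ≥0∞ :=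
  ∑ k ∈ Finset.range n, V k ω

/-- The number `N(t)` of claims up to and including time `t`: the largest `n` with `T n ≤ t`. -/
def claimCount (V : ℕ → Ω → ℝ≥0∞) (t : ℝ) (ω : Ω) : ℕ :=
  sSup {n : ℕ | arrivalTime V n ω ≤ ENNReal.ofReal t}

/-- The aggregate claim size `S(t)`, the sum of the first `N(t)` claim sizes. -/
def aggregateClaim (V : ℕ → Ω → ℝ≥0∞) (X : ℕ → Ω → ℝ) (t : ℝ) (ω : Ω) : ℝ :=
  ∑ i ∈ Finset.range (claimCount V t ω), X i ω

/-- The arrival process with inter-claim times `V` is a homogeneous Poisson process with rate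
`r ≥ 0`: the inter-claim times are independent and exponentially distributed,
`μ(V i > s) = exp (-r s)` (for `r = 0` this says that they are infinite almost surely). -/
def IsHomogeneousPoisson (μ : Measure Ω) (V : ℕ → Ω → ℝ≥0∞) (r : ℝ≥0) : Prop :=
  iIndepFun V μ ∧
    ∀ (i : ℕ) (s : ℝ≥0), μ {ω | (s : ℝ≥0∞) < V i ω} = ENNReal.ofReal (Real.exp (-(r * s)))

/-- The arrival process with inter-claim times `V` is a mixed Poisson process with structure
distribution `L`: its law is the mixture, over a rate distributed according to `L`, of the laws
of homogeneous Poisson processes. -/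
def IsMixedPoisson (μ : Measure Ω) (V : ℕ → Ω → ℝ≥0∞) (L : Measure ℝ≥0) : Prop :=
  ∃ κ : Kernel ℝ≥0 (ℕ → ℝ≥0∞), IsMarkovKernel κ ∧
    (∀ r : ℝ≥0, IsHomogeneousPoisson (κ r) (fun i v => v i) r) ∧
    μ.map (fun ω i => V i ω) = L.bind κ

/-- The sigma-algebra generated by the whole claim arrival process. -/
abbrev arrivalSigma (V : ℕ → Ω → ℝ≥0∞) : MeasurableSpace Ω :=
  MeasurableSpace.comap (fun ω i => V i ω) inferInstance

/-- Each claim size `X i` depends on the claim arrival process only via `V i`: its conditional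
distribution given the whole arrival process is its conditional distribution given `V i`. -/
def DependsOnlyOnGap (μ : Measure Ω) (V : ℕ → Ω → ℝ≥0∞) (X : ℕ → Ω → ℝ) : Prop :=
  ∀ (i : ℕ) (B : Set ℝ), MeasurableSet B →
    μ⟦X i ⁻¹' B | arrivalSigma V⟧ =ᵐ[μ] μ⟦X i ⁻¹' B | MeasurableSpace.comap (V i) inferInstance⟧

/-- The claim sizes are conditionally independent given the claim arrival process. -/
def CondIndepClaims (μ : Measure Ω) (V : ℕ → Ω → ℝ≥0∞) (X : ℕ → Ω → ℝ) : Prop :=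
  ∀ (s : Finset ℕ) (B : ℕ → Set ℝ), (∀ i, MeasurableSet (B i)) →
    μ⟦⋂ i ∈ s, X i ⁻¹' B i | arrivalSigma V⟧ =ᵐ[μ]
      ∏ i ∈ s, μ⟦X i ⁻¹' B i | arrivalSigma V⟧

section Moments

variable (μ : Measure Ω) [IsFiniteMeasure μ] (V : ℕ → Ω → ℝ≥0∞) (X : ℕ → Ω → ℝ)

/-- The conditional distribution of `X i` given `V i = v`. -/
def claimLaw (i : ℕ) (v : ℝ) : Measure ℝ :=
  condDistrib (X i) (V i) μ (ENNReal.ofReal v)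

/-- `E[X i | V i = v]`. -/
def condMean (i : ℕ) (v : ℝ) : ℝ := ∫ x, x ∂(claimLaw μ V X i v)

/-- `E[(X i)² | V i = v]`. -/
def condSecond (i : ℕ) (v : ℝ) : ℝ := ∫ x, x ^ 2 ∂(claimLaw μ V X i v)

/-- `Θ(n|v)`, the sum of the conditional second moments of the first `n` claims. -/
def Theta (n : ℕ) (v : ℝ) : ℝ := ∑ i ∈ Finset.range n, condSecond μ V X i v

/-- `Υ(n|y,v)`, the sum over ordered pairs `i ≠ j` among the first `n` claims of
`E[X i | V i = y] * E[X j | V j = v]`. -/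
def Upsilon (n : ℕ) (y v : ℝ) : ℝ :=
  ∑ i ∈ Finset.range n, ∑ j ∈ (Finset.range n).erase i, condMean μ V X i y * condMean μ V X j v

/-- `E[X i | V i = v]` as an element of `[0, ∞]`, for nonnegative `X i`. -/
def condMeanENN (i : ℕ) (v : ℝ) : ℝ≥0∞ := ∫⁻ x, ENNReal.ofReal x ∂(claimLaw μ V X i v)

/-- `E[(X i)² | V i = v]` as an element of `[0, ∞]`. -/
def condSecondENN (i : ℕ) (v : ℝ) : ℝ≥0∞ := ∫⁻ x, ENNReal.ofReal (x ^ 2) ∂(claimLaw μ V X i v)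

/-- `Θ(n|v)` as an element of `[0, ∞]`. -/
def ThetaENN (n : ℕ) (v : ℝ) : ℝ≥0∞ := ∑ i ∈ Finset.range n, condSecondENN μ V X i v

/-- `Υ(n|y,v)` as an element of `[0, ∞]`, for nonnegative claim sizes. -/
def UpsilonENN (n : ℕ) (y v : ℝ) : ℝ≥0∞ :=
  ∑ i ∈ Finset.range n, ∑ j ∈ (Finset.range n).erase i,
    condMeanENN μ V X i y * condMeanENN μ V X j v

end Moments

/-- The distribution of `N_r(s)`, the number of claims up to time `s ≥ 0` in a homogeneous Poisson
process with rate `r`: the Poisson distribution with parameter `r * s`. -/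
def poissonCountLaw (r : ℝ≥0) (s : ℝ) : Measure ℕ := poissonMeasure (r * s.toNNReal)

end

end AggregateClaims

open AggregateClaims

namespace AggregateClaims

/-! Expand the square of the sum into diagonal terms `X i ^ 2` and off-diagonal terms `X i * X j`.
Outside the null event of explosion, claim `i` (counted from 0) is included exactly when
`arrivalTime V (i + 1) ≤ t`, and the pair `i ≠ j` exactly when `arrivalTime V (max i j + 1) ≤ t`.
The random sum thus becomes a series over fixed indices with indicators that depend on the arrivals
only.

Given the arrivals, `X i` and `X j` are independent with the conditional laws given their own gaps
(`lintegral_arrival_claims`), so each term is an integral over gaps alone. For a fixed rate `r`,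
take the gap `v` of claim `i` out of the sum: it has density `r * exp (-(r * v))`, and the other `i`
gaps must fit into `t - v`, which has the probability that `N_r(t - v) ≥ i` (`measure_sum_gap_le`).
Only the number of remaining gaps matters, not their position. Summing over `i` turns these tails
into an expectation of a sum over `i < N_r(t - v) + 1`, which is the `Θ` term. For a pair, two gaps
are taken out and `max i j - 1` remain; this produces the factor `r ^ 2` and the shift by 2 in the
`Υ` term. Integrating over `L` gives the mixed process.

All of this is done with values in `[0, ∞]` for an arbitrary nonnegative measurable `h (X i, X j)`,
where Tonelli needs no integrability. Nonnegative claims use the product itself. Signed claims use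
the positive and the negative part of the product, both dominated by its absolute value, whose
integral is finite by hypothesis; subtracting gives the real identity. -/

/-! ### Exponential densities and Poisson probabilities. -/

lemma poissonCountLaw_singleton (r : ℝ≥0) {s : ℝ} (hs : 0 ≤ s) (n : ℕ) :
    poissonCountLaw r s {n} = ENNReal.ofReal (Real.exp (-(r * s)) * (r * s) ^ n / n.factorial) := by
  rw [poissonCountLaw, poissonMeasure_singleton]
  simp [Real.coe_toNNReal s hs]

instance (r : ℝ≥0) (s : ℝ) : IsProbabilityMeasure (poissonCountLaw r s) := by
  unfold poissonCountLaw; infer_instance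

lemma lintegral_exp_density_Icc (r : ℝ≥0) {s : ℝ} (hs : 0 ≤ s) :
    ∫⁻ v in Set.Icc (0 : ℝ) s, ENNReal.ofReal (r * Real.exp (-(r * v)))
      = ENNReal.ofReal (1 - Real.exp (-(r * s))) := by
  rw [← ofReal_integral_eq_lintegral_ofReal, integral_Icc_eq_integral_Ioc,
    ← intervalIntegral.integral_of_le hs]
  · congr 1
    rw [intervalIntegral.integral_eq_sub_of_hasDerivAt
      (f := fun v => -Real.exp (-(r * v))) (fun _ _ => hasDerivAt_neg_exp_mul_exp)]
    · simp; ring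
    · exact Continuous.intervalIntegrable (by fun_prop) _ _
  · exact (Continuous.continuousOn (by fun_prop)).integrableOn_Icc
  · exact Filter.Eventually.of_forall fun v => by positivity

lemma lintegral_exp_density_Ici (r : ℝ≥0) :
    ∫⁻ v in Set.Ici (0 : ℝ), ENNReal.ofReal (r * Real.exp (-(r * v)))
      = if r = 0 then 0 else 1 := by
  split_ifs with h
  · simp [h]
  · have hr : (0 : ℝ) < r := by positivity
    rw [← lintegral_exponentialPDF_eq_one hr, ← lintegral_indicator measurableSet_Ici]
    congr with v
    by_cases hv : 0 ≤ v <;> simp [exponentialPDF_eq, hv]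

/-- Decomposition at the first claim: if it occurs at time `v`, then `n` further claims must fall in
the remaining time `s - v`. -/
lemma lintegral_exp_density_mul_poissonCountLaw (r : ℝ≥0) {s : ℝ} (hs : 0 ≤ s) (n : ℕ) :
    ∫⁻ v in Set.Icc (0 : ℝ) s, ENNReal.ofReal (r * Real.exp (-(r * v))) *
        poissonCountLaw r (s - v) {n} = poissonCountLaw r s {n + 1} := by
  have h1 : ∀ v ∈ Set.Icc (0 : ℝ) s, ENNReal.ofReal (r * Real.exp (-(r * v))) *
      poissonCountLaw r (s - v) {n} = ENNReal.ofReal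
        (Real.exp (-(r * s)) * (r * (r * (s - v)) ^ n / n.factorial)) := by
    intro v hv
    rw [poissonCountLaw_singleton r (sub_nonneg.2 hv.2), ← ENNReal.ofReal_mul (by positivity)]
    congr 1
    have : Real.exp (-(r * s)) = Real.exp (-(r * v)) * Real.exp (-(r * (s - v))) := by
      rw [← Real.exp_add]; ring_nf
    rw [this]; ring
  rw [setLIntegral_congr_fun measurableSet_Icc h1, ← ofReal_integral_eq_lintegral_ofReal,
    integral_Icc_eq_integral_Ioc, ← intervalIntegral.integral_of_le hs,
    poissonCountLaw_singleton r hs]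
  · congr 1
    -- The exponentials combine to a constant, leaving a polynomial in `v`. Its antiderivative
    -- vanishes at `v = s` and is minus the Poisson weight of `n + 1` at `v = 0`.
    have hd : ∀ v : ℝ, HasDerivAt
        (fun v : ℝ => -(Real.exp (-(r * s)) * ((r * (s - v)) ^ (n + 1) / (n + 1).factorial)))
        (Real.exp (-(r * s)) * (r * (r * (s - v)) ^ n / n.factorial)) v := by
      intro v
      have h2 : HasDerivAt (fun v : ℝ => (r : ℝ) * (s - v)) (-r) v := by
        simpa using ((hasDerivAt_id v).const_sub s).const_mul (r : ℝ)
      convert! ((((h2.pow (n + 1)).div_const ((n + 1).factorial : ℝ))).const_mul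
        (Real.exp (-(r * s)))).neg using 1
      rw [Nat.factorial_succ]
      push_cast
      field_simp
    rw [intervalIntegral.integral_eq_sub_of_hasDerivAt (fun v _ => hd v)]
    · simp; ring
    · exact Continuous.intervalIntegrable (by fun_prop) _ _
  · exact (Continuous.continuousOn (by fun_prop)).integrableOn_Icc
  · refine (ae_restrict_iff' measurableSet_Icc).2 (Filter.Eventually.of_forall fun v hv => ?_)
    have := sub_nonneg.2 hv.2
    simp only [Pi.zero_apply]
    positivity

/-- The distribution of `N_r(s)` depends measurably on `r` and `s`. -/
lemma measurable_poissonCountLaw_apply {β : Type*} [MeasurableSpace β] {f : β → ℝ≥0} {g : β → ℝ}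
    (hf : Measurable f) (hg : Measurable g) (S : Set ℕ) :
    Measurable fun b => poissonCountLaw (f b) (g b) S := by
  have h : ∀ b : β, poissonCountLaw (f b) (g b) S = ∑' n, ENNReal.ofReal
      (Real.exp (-((f b * (g b).toNNReal : ℝ≥0) : ℝ)) * ((f b * (g b).toNNReal : ℝ≥0) : ℝ) ^ n
        / n.factorial) * S.indicator 1 n := by
    intro p
    rw [poissonCountLaw, poissonMeasure, Measure.sum_apply _ .of_discrete]
    simp
  simp_rw [h]
  fun_prop

/-- The same first-claim decomposition for tails, by summing over the point masses. It is the
induction step of `measure_sum_gap_le`. -/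
lemma lintegral_exp_density_mul_poissonCountLaw_Ici (r : ℝ≥0) {s : ℝ} (hs : 0 ≤ s) (k : ℕ) :
    ∫⁻ v in Set.Icc (0 : ℝ) s, ENNReal.ofReal (r * Real.exp (-(r * v))) *
        poissonCountLaw r (s - v) (Set.Ici k) = poissonCountLaw r s (Set.Ici (k + 1)) := by
  have h : ∀ (μ : Measure ℕ) (k : ℕ), μ (Set.Ici k) = ∑' n, μ {k + n} := by
    intro μ k
    rw [← measure_iUnion (fun i j hij => by simpa using hij) fun i => MeasurableSet.singleton _]
    congr 1
    ext n
    simp only [Set.mem_Ici, Set.mem_iUnion, Set.mem_singleton_iff]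
    exact le_iff_exists_add
  have hm : ∀ n : ℕ, Measurable fun v : ℝ => poissonCountLaw r (s - v) {n} := fun n =>
    measurable_poissonCountLaw_apply (f := fun _ => r) measurable_const (by fun_prop) _
  have hm' : ∀ n : ℕ, AEMeasurable (fun v : ℝ => ENNReal.ofReal (r * Real.exp (-(r * v))) *
      poissonCountLaw r (s - v) {n}) (volume.restrict (Set.Icc 0 s)) := fun n =>
    (Measurable.mul (by fun_prop) (hm n)).aemeasurable
  simp_rw [h, ← ENNReal.tsum_mul_left]
  refine (lintegral_tsum fun n => hm' (k + n)).trans (tsum_congr fun n => ?_)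
  rw [lintegral_exp_density_mul_poissonCountLaw r hs, add_right_comm]

/-! ### The law of a single gap. -/

section Gap

variable {Ω : Type*} [MeasurableSpace Ω] {μ : Measure Ω} {r : ℝ≥0}

/-- Both measures agree on all `Set.Iic a`. The atom at `∞` is needed only for rate 0, where the
density vanishes and the gap is almost surely infinite. -/
lemma map_eq_of_exponential_survival [IsProbabilityMeasure μ] {Y : Ω → ℝ≥0∞}
    (hY : Measurable Y)
    (h : ∀ s : ℝ≥0, μ {ω | (s : ℝ≥0∞) < Y ω} = ENNReal.ofReal (Real.exp (-(r * s)))) :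
    μ.map Y = ((volume.restrict (Set.Ici (0 : ℝ))).withDensity
        fun v => ENNReal.ofReal (r * Real.exp (-(r * v)))).map ENNReal.ofReal
      + (if r = 0 then 1 else 0 : ℝ≥0∞) • Measure.dirac ∞ := by
  have : IsProbabilityMeasure (μ.map Y) := Measure.isProbabilityMeasure_map hY.aemeasurable
  refine Measure.ext_of_Iic _ _ fun a => ?_
  rw [Measure.add_apply, Measure.map_apply ENNReal.measurable_ofReal measurableSet_Iic,
    withDensity_apply _ (ENNReal.measurable_ofReal measurableSet_Iic),
    Measure.restrict_restrict (ENNReal.measurable_ofReal measurableSet_Iic)]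
  induction a with
  | top =>
    have : (ENNReal.ofReal ⁻¹' Set.Iic ∞) ∩ Set.Ici (0 : ℝ) = Set.Ici 0 := by ext; simp
    rw [this, lintegral_exp_density_Ici]
    by_cases hr : r = 0 <;> simp [hr]
  | coe s =>
    have : (ENNReal.ofReal ⁻¹' Set.Iic (s : ℝ≥0∞)) ∩ Set.Ici (0 : ℝ) = Set.Icc 0 (s : ℝ) := by
      ext v
      simp only [Set.mem_inter_iff, Set.mem_preimage, Set.mem_Iic, Set.mem_Ici, Set.mem_Icc,
        ENNReal.ofReal_le_coe]
      tauto
    rw [this, lintegral_exp_density_Icc r s.coe_nonneg, Measure.map_apply hY measurableSet_Iic]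
    have h2 : Y ⁻¹' Set.Iic (s : ℝ≥0∞) = {ω | (s : ℝ≥0∞) < Y ω}ᶜ := by ext; simp
    rw [h2, prob_compl_eq_one_sub (measurableSet_lt measurable_const hY), h,
      ENNReal.ofReal_sub _ (by positivity)]
    by_cases hr : r = 0 <;> simp [hr]

/-- A test function that vanishes beyond `t` does not see the atom at `∞`, so one formula covers
every rate, including 0. -/
lemma lintegral_comp_of_exponential_survival [IsProbabilityMeasure μ] {Y : Ω → ℝ≥0∞}
    (hY : Measurable Y)
    (h : ∀ s : ℝ≥0, μ {ω | (s : ℝ≥0∞) < Y ω} = ENNReal.ofReal (Real.exp (-(r * s))))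
    {f : ℝ≥0∞ → ℝ≥0∞} (hf : Measurable f) {t : ℝ} (hft : ∀ a, ENNReal.ofReal t < a → f a = 0) :
    ∫⁻ ω, f (Y ω) ∂μ =
      ∫⁻ v in Set.Icc (0 : ℝ) t, ENNReal.ofReal (r * Real.exp (-(r * v)))
        * f (ENNReal.ofReal v) := by
  rw [← lintegral_map hf hY, map_eq_of_exponential_survival hY h, lintegral_add_measure,
    lintegral_smul_measure, lintegral_dirac' _ hf, hft ∞ ENNReal.ofReal_lt_top,
    lintegral_map hf ENNReal.measurable_ofReal,
    lintegral_withDensity_eq_lintegral_mul _ (by fun_prop)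
      (g := fun v => f (ENNReal.ofReal v)) (hf.comp ENNReal.measurable_ofReal),
    smul_zero, add_zero, ← lintegral_indicator measurableSet_Ici,
    ← lintegral_indicator measurableSet_Icc]
  refine lintegral_congr_ae ?_
  -- For negative `t`, the point `v = 0` lies outside the interval although `ENNReal.ofReal 0` does
  -- not exceed `ENNReal.ofReal t`; it is discarded as a null set.
  filter_upwards [Measure.ae_ne volume (0 : ℝ)] with v hv0
  by_cases hv : v ∈ Set.Icc 0 t
  · simp [hv, hv.1]
  · by_cases h0 : 0 ≤ v
    · have : ENNReal.ofReal t < ENNReal.ofReal v :=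
        (ENNReal.ofReal_lt_ofReal_iff (lt_of_le_of_ne h0 hv0.symm)).2
          (lt_of_not_ge fun h' => hv ⟨h0, h'⟩)
      simp [hv, h0, hft _ this]
    · simp [hv, h0]

end Gap

/-! ### Independent exponential gaps: sums, and integrals over one or two distinguished gaps. -/

section Gap

variable {Ω : Type*} [MeasurableSpace Ω] {μ : Measure Ω} {r : ℝ≥0}

lemma lintegral_comp_prodMk_of_indepFun {α β : Type*} [MeasurableSpace α] [MeasurableSpace β]
    [IsProbabilityMeasure μ] {A : Ω → α} {B : Ω → β} (hA : Measurable A) (hB : Measurable B)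
    (h : IndepFun A B μ) {G : α → β → ℝ≥0∞} (hG : Measurable (Function.uncurry G)) :
    ∫⁻ ω, G (A ω) (B ω) ∂μ = ∫⁻ ω, ∫⁻ ω', G (A ω) (B ω') ∂μ ∂μ := by
  have : IsProbabilityMeasure (μ.map B) := Measure.isProbabilityMeasure_map hB.aemeasurable
  have h1 : ∫⁻ ω, G (A ω) (B ω) ∂μ
      = ∫⁻ p, Function.uncurry G p ∂(μ.map fun ω => (A ω, B ω)) := by
    rw [lintegral_map hG (hA.prodMk hB)]; rfl
  rw [h1, (indepFun_iff_map_prod_eq_prod_map_map hA.aemeasurable hB.aemeasurable).1 h,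
    lintegral_prod _ hG.aemeasurable, lintegral_map hG.lintegral_prod_right' hA]
  refine lintegral_congr fun ω => ?_
  exact lintegral_map (f := fun b => Function.uncurry G (A ω, b))
    (hG.comp measurable_prodMk_left) hB

/-- One variable of an independent family is independent of any function of finitely many
others. -/
lemma indepFun_of_notMem_finset {ι α β : Type*} [MeasurableSpace α] [MeasurableSpace β]
    {Y : ι → Ω → α} (hY : ∀ i, Measurable (Y i)) (h : iIndepFun Y μ) {i : ι} {T : Finset ι}
    (hi : i ∉ T) {g : (T → α) → β} (hg : Measurable g) :
    IndepFun (Y i) (fun ω => g fun k => Y k ω) μ :=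
  (h.indepFun_finset {i} T (by simpa using hi) hY).comp
    (φ := fun x : (({i} : Finset ι) → α) => x ⟨i, Finset.mem_singleton_self i⟩) (by fun_prop) hg

lemma ofReal_add_le_ofReal_iff {t v : ℝ} (hv : 0 ≤ v) (hvt : v ≤ t) (s : ℝ≥0∞) :
    ENNReal.ofReal v + s ≤ ENNReal.ofReal t ↔ s ≤ ENNReal.ofReal (t - v) := by
  rw [ENNReal.ofReal_sub _ hv, ENNReal.le_sub_iff_add_le_left ENNReal.ofReal_ne_top
    (ENNReal.ofReal_le_ofReal hvt)]

variable {ι : Type*} {Y : ι → Ω → ℝ≥0∞}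

/-- Condition on `A`: by independence, `A = v` leaves the event that `S` fits into `t - v`. The law
of `S` is arbitrary here. -/
lemma lintegral_gap_add_le [IsProbabilityMeasure μ] {A S : Ω → ℝ≥0∞} (hA : Measurable A)
    (hS : Measurable S)
    (h : ∀ s : ℝ≥0, μ {ω | (s : ℝ≥0∞) < A ω} = ENNReal.ofReal (Real.exp (-(r * s))))
    (hind : IndepFun A S μ) (t : ℝ) {g : ℝ≥0∞ → ℝ≥0∞} (hg : Measurable g) :
    ∫⁻ ω, g (A ω) * {ω | A ω + S ω ≤ ENNReal.ofReal t}.indicator 1 ω ∂μ =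
      ∫⁻ v in Set.Icc (0 : ℝ) t, ENNReal.ofReal (r * Real.exp (-(r * v))) *
        (g (ENNReal.ofReal v) * μ {ω | S ω ≤ ENNReal.ofReal (t - v)}) := by
  have hK : MeasurableSet {p : ℝ≥0∞ × ℝ≥0∞ | p.1 + p.2 ≤ ENNReal.ofReal t} :=
    measurableSet_le (by fun_prop) measurable_const
  have hG : Measurable (Function.uncurry fun a s : ℝ≥0∞ =>
      g a * {p : ℝ≥0∞ × ℝ≥0∞ | p.1 + p.2 ≤ ENNReal.ofReal t}.indicator 1 (a, s)) :=
    (hg.comp measurable_fst).mul (measurable_one.indicator hK)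
  have hμ : ∀ a : ℝ≥0∞, MeasurableSet {ω | a + S ω ≤ ENNReal.ofReal t} := fun a =>
    measurableSet_le (by fun_prop) measurable_const
  have hf : ∀ a : ℝ≥0∞, ∫⁻ ω', g a *
      {p : ℝ≥0∞ × ℝ≥0∞ | p.1 + p.2 ≤ ENNReal.ofReal t}.indicator 1 (a, S ω') ∂μ =
        g a * μ {ω | a + S ω ≤ ENNReal.ofReal t} := by
    intro a
    rw [← lintegral_indicator_one (hμ a),
      ← lintegral_const_mul _ (measurable_one.indicator (hμ a))]
    rfl
  refine (lintegral_comp_prodMk_of_indepFun hA hS hind hG).trans ?_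
  have hm : Measurable fun a => g a * μ {ω | a + S ω ≤ ENNReal.ofReal t} := by
    simp_rw [← hf]
    exact (hG.comp ((measurable_fst).prodMk (hS.comp measurable_snd))).lintegral_prod_right'
  simp_rw [hf]
  rw [lintegral_comp_of_exponential_survival (t := t) hA h hm]
  · refine setLIntegral_congr_fun measurableSet_Icc fun v hv => ?_
    simp only [ofReal_add_le_ofReal_iff hv.1 hv.2]
  · intro a ha
    have : {ω | a + S ω ≤ ENNReal.ofReal t} = ∅ :=
      Set.eq_empty_of_forall_notMem fun ω hω => (ha.trans_le le_self_add).not_ge hω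
    simp [this]

lemma measurable_finset_sum_gap (hY : ∀ i, Measurable (Y i)) (F : Finset ι) :
    Measurable fun ω => ∑ k ∈ F, Y k ω := by fun_prop

lemma indepFun_gap_sum (hY : ∀ i, Measurable (Y i)) (h : iIndepFun Y μ) {i : ι} {F : Finset ι}
    (hi : i ∉ F) : IndepFun (Y i) (fun ω => ∑ k ∈ F, Y k ω) μ := by
  have := indepFun_of_notMem_finset hY h hi (g := fun x => ∑ k, x k) (by fun_prop)
  have hs : ∀ ω, ∑ k : F, Y k ω = ∑ k ∈ F, Y k ω := fun ω => Finset.sum_coe_sort F fun k => Y k ω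
  simpa only [hs] using this

/-- The sum of `n` independent exponential gaps is at most `s` exactly with the probability that a
Poisson variable is at least `n`. -/
lemma measure_sum_gap_le [IsProbabilityMeasure μ] (hY : ∀ i, Measurable (Y i))
    (h : iIndepFun Y μ)
    (he : ∀ i, ∀ s : ℝ≥0, μ {ω | (s : ℝ≥0∞) < Y i ω} = ENNReal.ofReal (Real.exp (-(r * s))))
    (F : Finset ι) {s : ℝ} (hs : 0 ≤ s) :
    μ {ω | ∑ k ∈ F, Y k ω ≤ ENNReal.ofReal s} = poissonCountLaw r s (Set.Ici F.card) := by
  classical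
  induction F using Finset.induction_on generalizing s with
  | empty =>
    have : Set.Ici 0 = (Set.univ : Set ℕ) := by ext; simp
    simp [this]
  | insert a F ha ih =>
    have hm : MeasurableSet {ω | Y a ω + ∑ k ∈ F, Y k ω ≤ ENNReal.ofReal s} :=
      measurableSet_le (by fun_prop) measurable_const
    have := lintegral_gap_add_le (hY a) (measurable_finset_sum_gap hY F) (he a)
      (indepFun_gap_sum hY h ha) s (g := fun _ => 1) measurable_const
    simp only [one_mul] at this
    rw [lintegral_indicator_one hm] at this
    simp only [Finset.sum_insert ha, Finset.card_insert_of_notMem ha]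
    rw [this, ← lintegral_exp_density_mul_poissonCountLaw_Ici r hs]
    exact setLIntegral_congr_fun measurableSet_Icc fun v hv => by
      simp only [ih (sub_nonneg.2 hv.2)]

lemma lintegral_gap_mul_sum_le [IsProbabilityMeasure μ] (hY : ∀ i, Measurable (Y i))
    (h : iIndepFun Y μ)
    (he : ∀ i, ∀ s : ℝ≥0, μ {ω | (s : ℝ≥0∞) < Y i ω} = ENNReal.ofReal (Real.exp (-(r * s))))
    {i : ι} {F : Finset ι} (hi : i ∉ F) (t : ℝ) {g : ℝ≥0∞ → ℝ≥0∞} (hg : Measurable g) :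
    ∫⁻ ω, g (Y i ω) * {ω | Y i ω + ∑ k ∈ F, Y k ω ≤ ENNReal.ofReal t}.indicator 1 ω ∂μ =
      ∫⁻ v in Set.Icc (0 : ℝ) t, ENNReal.ofReal (r * Real.exp (-(r * v))) *
        (g (ENNReal.ofReal v) * poissonCountLaw r (t - v) (Set.Ici F.card)) := by
  rw [lintegral_gap_add_le (hY i) (measurable_finset_sum_gap hY F) (he i)
      (indepFun_gap_sum hY h hi) t hg]
  exact setLIntegral_congr_fun measurableSet_Icc fun v hv => by
      simp only [measure_sum_gap_le hY h he F (sub_nonneg.2 hv.2)]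

/-- Condition on `Y i = y`, then apply the one-gap formula to `Y j` with horizon `t - y`. The two
densities multiply to `r ^ 2 * exp (-(r * (y + v)))`. -/
lemma lintegral_gap_pair_mul_sum_le [IsProbabilityMeasure μ] (hY : ∀ i, Measurable (Y i))
    (h : iIndepFun Y μ)
    (he : ∀ i, ∀ s : ℝ≥0, μ {ω | (s : ℝ≥0∞) < Y i ω} = ENNReal.ofReal (Real.exp (-(r * s))))
    {i j : ι} {F : Finset ι} (hij : i ≠ j) (hi : i ∉ F) (hj : j ∉ F) (t : ℝ)
    {g : ℝ≥0∞ → ℝ≥0∞ → ℝ≥0∞} (hg : Measurable (Function.uncurry g)) :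
    ∫⁻ ω, g (Y i ω) (Y j ω) *
        {ω | Y i ω + (Y j ω + ∑ k ∈ F, Y k ω) ≤ ENNReal.ofReal t}.indicator 1 ω ∂μ =
      ∫⁻ y in Set.Icc (0 : ℝ) t, ∫⁻ v in Set.Icc (0 : ℝ) (t - y),
        ENNReal.ofReal ((r : ℝ) ^ 2 * Real.exp (-(r * (y + v)))) *
        (g (ENNReal.ofReal y) (ENNReal.ofReal v) *
          poissonCountLaw r (t - y - v) (Set.Ici F.card)) := by
  classical
  set S : Ω → ℝ≥0∞ := fun ω => ∑ k ∈ F, Y k ω with hSdef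
  have hS : Measurable S := measurable_finset_sum_gap hY F
  have hT : i ∉ insert j F := by simp [hij, hi]
  -- Conditioning on `Y i` must leave the joint law of `Y j` and the remaining sum unchanged, so
  -- independence from the pair is required.
  have hind : IndepFun (Y i) (fun ω => (Y j ω, S ω)) μ := by
    have := indepFun_of_notMem_finset hY h hT
      (g := fun x : (↥(insert j F) → ℝ≥0∞) => (x ⟨j, Finset.mem_insert_self j F⟩,
        ∑ k : F, x ⟨k, Finset.mem_insert_of_mem k.2⟩)) (by fun_prop)
    have hs : ∀ ω, ∑ k : F, Y k ω = S ω := fun ω => Finset.sum_coe_sort F fun k => Y k ω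
    simpa only [hs] using this
  have hK : MeasurableSet {p : ℝ≥0∞ × ℝ≥0∞ × ℝ≥0∞ | p.1 + (p.2.1 + p.2.2) ≤ ENNReal.ofReal t} :=
    measurableSet_le (by fun_prop) measurable_const
  let G : ℝ≥0∞ → ℝ≥0∞ × ℝ≥0∞ → ℝ≥0∞ := fun a p => g a p.1 *
      {p : ℝ≥0∞ × ℝ≥0∞ × ℝ≥0∞ | p.1 + (p.2.1 + p.2.2) ≤ ENNReal.ofReal t}.indicator 1 (a, p)
  have hG : Measurable (Function.uncurry G) :=
    (hg.comp (measurable_fst.prodMk (measurable_fst.comp measurable_snd))).mul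
      (measurable_one.indicator hK)
  refine (lintegral_comp_prodMk_of_indepFun (hY i) ((hY j).prodMk hS) hind hG).trans ?_
  rw [lintegral_comp_of_exponential_survival (t := t) (hY i) (he i)
    (f := fun a => ∫⁻ ω', G a (Y j ω', S ω') ∂μ)
    (hG.comp (measurable_fst.prodMk
      (((hY j).prodMk hS).comp measurable_snd))).lintegral_prod_right']
  · refine setLIntegral_congr_fun measurableSet_Icc fun y hy => ?_
    have hgy : Measurable (g (ENNReal.ofReal y)) := hg.comp measurable_prodMk_left
    have h1 : ∫⁻ ω', G (ENNReal.ofReal y) (Y j ω', S ω') ∂μ =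
        ∫⁻ ω', g (ENNReal.ofReal y) (Y j ω') *
          {ω | Y j ω + S ω ≤ ENNReal.ofReal (t - y)}.indicator 1 ω' ∂μ := by
      refine lintegral_congr fun ω' => ?_
      simp only [G, Set.indicator_apply, Set.mem_ofPred_eq, ofReal_add_le_ofReal_iff hy.1 hy.2]
      rfl
    simp only [h1]
    rw [lintegral_gap_mul_sum_le hY h he hj (t - y) hgy,
      ← lintegral_const_mul' _ _ ENNReal.ofReal_ne_top]
    refine lintegral_congr fun v => ?_
    rw [← mul_assoc, ← ENNReal.ofReal_mul (by positivity)]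
    congr 2
    rw [mul_add, neg_add, Real.exp_add]
    ring
  · intro a ha
    have : ∀ ω', G a (Y j ω', S ω') = 0 := fun ω' => by
      simp only [G, Set.indicator_apply, Set.mem_ofPred_eq]
      rw [if_neg ((ha.trans_le le_self_add).not_ge), mul_zero]
    simp [this]

/-- A homogeneous Poisson process has finitely many arrivals in bounded time. -/
lemma measure_forall_arrivalTime_le [IsProbabilityMeasure μ] {V : ℕ → Ω → ℝ≥0∞}
    (hV : ∀ i, Measurable (V i)) (h : IsHomogeneousPoisson μ V r) {t : ℝ} (ht : 0 ≤ t) :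
    μ {ω | ∀ n, arrivalTime V n ω ≤ ENNReal.ofReal t} = 0 := by
  -- Explosion forces the first `n` gaps to fit into `t` for every `n`; the corresponding Poisson
  -- tails tend to 0.
  have hle : ∀ n : ℕ, μ {ω | ∀ n, arrivalTime V n ω ≤ ENNReal.ofReal t}
      ≤ poissonCountLaw r t (Set.Ici n) := by
    intro n
    have := measure_sum_gap_le hV h.1 h.2 (Finset.range n) ht
    rw [Finset.card_range] at this
    rw [← this]
    exact measure_mono fun ω hω => hω n
  have hlim : Filter.Tendsto (fun n => poissonCountLaw r t (Set.Ici n)) Filter.atTop (nhds 0) := by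
    have h0 : (⋂ n, Set.Ici n : Set ℕ) = ∅ :=
      Set.eq_empty_of_forall_notMem fun m hm => absurd (Set.mem_iInter.1 hm (m + 1)) (by simp)
    have := tendsto_measure_iInter_atTop (μ := poissonCountLaw r t) (s := fun n : ℕ => Set.Ici n)
      (fun n => MeasurableSet.of_discrete.nullMeasurableSet)
      (fun a b hab => Set.Ici_subset_Ici.2 hab) ⟨0, measure_ne_top _ _⟩
    rwa [h0, measure_empty] at this
  exact le_antisymm (ge_of_tendsto' hlim hle) bot_le

end Gap

/-! ### The claim count and the arrival times. -/

section Count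

variable {Ω : Type*}

lemma arrivalTime_mono (V : ℕ → Ω → ℝ≥0∞) (ω : Ω) : Monotone fun n => arrivalTime V n ω :=
  fun _ _ h => Finset.sum_le_sum_of_subset (Finset.range_mono h)

/-- The first conjunct excludes explosion. Without it the set of admissible `n` is unbounded and its
`sSup` in `ℕ` takes the default value 0, so the count would be 0 although all claims arrive by `t`.
-/
lemma lt_claimCount_iff {V : ℕ → Ω → ℝ≥0∞} {t : ℝ} {ω : Ω} {i : ℕ} :
    i < claimCount V t ω ↔ (∃ n, ENNReal.ofReal t < arrivalTime V n ω) ∧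
      arrivalTime V (i + 1) ω ≤ ENNReal.ofReal t := by
  have h0 : arrivalTime V 0 ω ≤ ENNReal.ofReal t := by simp [arrivalTime]
  by_cases h : ∃ n, ENNReal.ofReal t < arrivalTime V n ω
  · obtain ⟨n, hn⟩ := h
    have hb : BddAbove {n : ℕ | arrivalTime V n ω ≤ ENNReal.ofReal t} :=
      ⟨n, fun k hk => le_of_not_gt fun hnk =>
        (hn.trans_le (arrivalTime_mono V ω hnk.le)).not_ge hk⟩
    refine ⟨fun hi => ⟨⟨n, hn⟩, ?_⟩, fun hi => Nat.lt_of_succ_le (le_csSup hb hi.2)⟩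
    exact (arrivalTime_mono V ω (Nat.succ_le_of_lt hi)).trans (Nat.sSup_mem ⟨0, h0⟩ hb)
  · refine ⟨fun hi => ?_, fun hi => absurd hi.1 h⟩
    push Not at h
    have : {n : ℕ | arrivalTime V n ω ≤ ENNReal.ofReal t} = Set.univ :=
      Set.eq_univ_of_forall h
    simp [claimCount, this] at hi

variable [MeasurableSpace Ω] {V : ℕ → Ω → ℝ≥0∞} {t : ℝ}

lemma measurable_arrivalTime (hV : ∀ i, Measurable (V i)) (n : ℕ) :
    Measurable (arrivalTime V n) := by
  unfold arrivalTime; fun_prop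

lemma measurable_claimCount (hV : ∀ i, Measurable (V i)) (t : ℝ) :
    Measurable (claimCount V t) := by
  refine measurable_of_Ioi fun i => ?_
  have : claimCount V t ⁻¹' Set.Ioi i = (⋃ n, {ω | ENNReal.ofReal t < arrivalTime V n ω}) ∩
      {ω | arrivalTime V (i + 1) ω ≤ ENNReal.ofReal t} := by
    ext ω
    simp [lt_claimCount_iff]
  rw [this]
  exact (MeasurableSet.iUnion fun n =>
    measurableSet_lt measurable_const (measurable_arrivalTime hV n)).inter
      (measurableSet_le (measurable_arrivalTime hV _) measurable_const)

lemma measurable_comp_claimCount {β : Type*} [MeasurableSpace β] (hV : ∀ i, Measurable (V i))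
    (t : ℝ) {F : ℕ → Ω → β} (hF : ∀ n, Measurable (F n)) :
    Measurable fun ω => F (claimCount V t ω) ω := by
  have h : Measurable fun p : ℕ × Ω => F p.1 p.2 :=
    measurable_from_prod_countable_right fun n => hF n
  exact h.comp ((measurable_claimCount hV t).prodMk measurable_id)

end Count

/-! ### The joint law of the arrival process and two claim sizes. -/

section Joint

variable {Ω : Type*} [MeasurableSpace Ω] {P : Measure Ω} [IsProbabilityMeasure P]
  {V : ℕ → Ω → ℝ≥0∞} {X : ℕ → Ω → ℝ}

/-- Conditional independence factors the conditional probability given all arrivals, and dependence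
through the own gap identifies each factor with `condDistrib`. Integrating over an event of the
arrival sigma-algebra removes the conditioning. -/
lemma measure_inter_claims_eq (hV : ∀ i, Measurable (V i)) (hX : ∀ i, Measurable (X i))
    (hdep : DependsOnlyOnGap P V X) (hind : CondIndepClaims P V X) {i j : ℕ} (hij : i ≠ j)
    {A : Set (ℕ → ℝ≥0∞)} {B C : Set ℝ} (hA : MeasurableSet A) (hB : MeasurableSet B)
    (hC : MeasurableSet C) :
    P ((fun ω k => V k ω) ⁻¹' A ∩ (X i ⁻¹' B ∩ X j ⁻¹' C)) =
      ∫⁻ ω in (fun ω k => V k ω) ⁻¹' A, condDistrib (X i) (V i) P (V i ω) B *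
        condDistrib (X j) (V j) P (V j ω) C ∂P := by
  have hVm : Measurable fun ω k => V k ω := measurable_pi_lambda _ hV
  have hm : arrivalSigma V ≤ _ := hVm.comap_le
  have hlaw : ∀ (i : ℕ) {B : Set ℝ}, MeasurableSet B →
      P⟦X i ⁻¹' B | arrivalSigma V⟧ =ᵐ[P] fun ω =>
        (condDistrib (X i) (V i) P (V i ω)).real B := fun i B hB =>
    (hdep i B hB).trans (condDistrib_ae_eq_condExp (hV i) (hX i) hB).symm
  have hD : MeasurableSet (X i ⁻¹' B ∩ X j ⁻¹' C) := (hX i hB).inter (hX j hC)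
  have hAm : MeasurableSet ((fun ω k => V k ω) ⁻¹' A) := hVm hA
  have hprod : P⟦X i ⁻¹' B ∩ X j ⁻¹' C | arrivalSigma V⟧ =ᵐ[P] fun ω =>
      (condDistrib (X i) (V i) P (V i ω)).real B *
        (condDistrib (X j) (V j) P (V j ω)).real C := by
    have h := hind {i, j} (fun k => if k = i then B else C) fun k => by split_ifs <;> assumption
    rw [Finset.prod_pair hij] at h
    have hset : (⋂ k ∈ ({i, j} : Finset ℕ), X k ⁻¹' (if k = i then B else C)) =
        X i ⁻¹' B ∩ X j ⁻¹' C := by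
      rw [Finset.set_biInter_insert, Finset.set_biInter_singleton]
      simp [hij.symm]
    rw [hset] at h
    simp only [if_true, if_neg hij.symm] at h
    filter_upwards [h, hlaw i hB, hlaw j hC] with ω h1 h2 h3
    rw [h1, Pi.mul_apply, h2, h3]
  have hint := setIntegral_condExp (μ := P) hm (f := (X i ⁻¹' B ∩ X j ⁻¹' C).indicator fun _ => (1 : ℝ))
    ((integrable_const (1 : ℝ)).indicator hD)
    (⟨A, hA, rfl⟩ : MeasurableSet[arrivalSigma V] ((fun ω k => V k ω) ⁻¹' A))
  rw [setIntegral_congr_ae hAm (hprod.mono fun ω h _ => h), integral_indicator_const _ hD,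
    measureReal_restrict_apply hD, smul_eq_mul, mul_one] at hint
  have hmeas : ∀ (i : ℕ) {B : Set ℝ}, MeasurableSet B →
      Measurable fun ω => condDistrib (X i) (V i) P (V i ω) B := fun i B hB =>
    (Kernel.measurable_coe _ hB).comp (hV i)
  have hfin : ∫⁻ ω in (fun ω k => V k ω) ⁻¹' A, condDistrib (X i) (V i) P (V i ω) B *
        condDistrib (X j) (V j) P (V j ω) C ∂P ≠ ∞ := by
    refine ne_top_of_le_ne_top (measure_ne_top P ((fun ω k => V k ω) ⁻¹' A)) ?_
    rw [← setLIntegral_one]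
    exact lintegral_mono fun ω => mul_le_one' prob_le_one prob_le_one
  rw [← ENNReal.toReal_eq_toReal_iff' (measure_ne_top _ _) hfin, Set.inter_comm,
    ← measureReal_def, ← hint]
  refine Eq.trans ?_ (integral_toReal ((hmeas i hB).mul (hmeas j hC)).aemeasurable ?_)
  · simp [measureReal_def]
  · exact Filter.Eventually.of_forall fun ω =>
      (mul_le_one' prob_le_one prob_le_one).trans_lt ENNReal.one_lt_top

/-- Given the arrival process, two distinct claims are independent with the conditional
distributions given their own gaps. -/
lemma lintegral_arrival_claims (hV : ∀ i, Measurable (V i)) (hX : ∀ i, Measurable (X i))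
    (hdep : DependsOnlyOnGap P V X) (hind : CondIndepClaims P V X) {i j : ℕ} (hij : i ≠ j)
    {G : (ℕ → ℝ≥0∞) × ℝ × ℝ → ℝ≥0∞} (hG : Measurable G) :
    ∫⁻ ω, G (fun k => V k ω, X i ω, X j ω) ∂P =
      ∫⁻ a, ∫⁻ x, G (a, x) ∂((condDistrib (X i) (V i) P (a i)).prod
        (condDistrib (X j) (V j) P (a j))) ∂(P.map fun ω k => V k ω) := by
  have hVm : Measurable fun ω k => V k ω := measurable_pi_lambda _ hV
  let K : Kernel (ℕ → ℝ≥0∞) (ℝ × ℝ) :=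
    ((condDistrib (X i) (V i) P).comap (fun a : ℕ → ℝ≥0∞ => a i) (measurable_pi_apply i)) ×ₖ
    ((condDistrib (X j) (V j) P).comap (fun a : ℕ → ℝ≥0∞ => a j) (measurable_pi_apply j))
  have : IsProbabilityMeasure (P.map fun ω k => V k ω) :=
    Measure.isProbabilityMeasure_map hVm.aemeasurable
  have hY : Measurable fun ω => ((fun k => V k ω : ℕ → ℝ≥0∞), X i ω, X j ω) :=
    hVm.prodMk ((hX i).prodMk (hX j))
  -- Measurable boxes determine the joint law, so the previous lemma says that it is the arrival law
  -- composed with the product kernel.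
  have key : P.map (fun ω => ((fun k => V k ω : ℕ → ℝ≥0∞), X i ω, X j ω)) =
      (P.map fun ω k => V k ω) ⊗ₘ K := by
    refine (Measure.ext_prod₃ fun {A B C} hA hB hC => ?_).symm
    rw [Measure.compProd_apply_prod hA (hB.prod hC), Measure.map_apply hY (hA.prod (hB.prod hC)),
      setLIntegral_map hA (K.measurable_coe (hB.prod hC)) hVm]
    refine Eq.trans ?_ (measure_inter_claims_eq hV hX hdep hind hij hA hB hC).symm
    refine lintegral_congr fun ω => ?_
    simp [K, Kernel.prod_apply]
  rw [← lintegral_map hG hY, key, Measure.lintegral_compProd hG]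
  simp [K, Kernel.prod_apply]

end Joint

/-! ### Single terms of the expansion under the mixed Poisson law. -/

section Mixed

/-- Explosion has probability 0 for every rate, hence also under the mixture. -/
lemma ae_exists_lt_arrivalTime {Ω : Type*} [MeasurableSpace Ω] {P : Measure Ω}
    {L : Measure ℝ≥0} {V : ℕ → Ω → ℝ≥0∞}
    (hV : ∀ i, Measurable (V i)) (hN : IsMixedPoisson P V L) {t : ℝ}
    (ht : 0 ≤ t) : ∀ᵐ ω ∂P, ∃ n, ENNReal.ofReal t < arrivalTime V n ω := by
  obtain ⟨K, hK, hpois, hlaw⟩ := hN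
  have hVm : Measurable fun ω k => V k ω := measurable_pi_lambda _ hV
  have hS : MeasurableSet {a : ℕ → ℝ≥0∞ |
      ∀ n, arrivalTime (fun i (v : ℕ → ℝ≥0∞) => v i) n a ≤ ENNReal.ofReal t} := by
    simp only [Set.ofPred_forall]
    exact MeasurableSet.iInter fun n => measurableSet_le
      (measurable_arrivalTime (fun i => measurable_pi_apply i) n) measurable_const
  have h0 : P.map (fun ω k => V k ω) {a : ℕ → ℝ≥0∞ |
      ∀ n, arrivalTime (fun i (v : ℕ → ℝ≥0∞) => v i) n a ≤ ENNReal.ofReal t} = 0 := by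
    rw [hlaw, Measure.bind_apply hS K.aemeasurable, lintegral_eq_zero_iff (K.measurable_coe hS)]
    exact Filter.Eventually.of_forall fun r =>
      measure_forall_arrivalTime_le (fun i => measurable_pi_apply i) (hpois r) ht
  rw [Measure.map_apply hVm hS] at h0
  rw [ae_iff]
  convert h0 using 2
  ext ω
  simp [arrivalTime]

variable {Ω : Type*} [MeasurableSpace Ω] {P : Measure Ω} [IsProbabilityMeasure P]
  {L : Measure ℝ≥0} {V : ℕ → Ω → ℝ≥0∞} {X : ℕ → Ω → ℝ}

lemma measurable_lintegral_condDistrib_prod (i j : ℕ) {h : ℝ × ℝ → ℝ≥0∞} (hh : Measurable h) :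
    Measurable (Function.uncurry fun b c : ℝ≥0∞ =>
      ∫⁻ x, h x ∂((condDistrib (X i) (V i) P b).prod (condDistrib (X j) (V j) P c))) := by
  let K : Kernel (ℝ≥0∞ × ℝ≥0∞) (ℝ × ℝ) :=
    ((condDistrib (X i) (V i) P).comap Prod.fst measurable_fst) ×ₖ
    ((condDistrib (X j) (V j) P).comap Prod.snd measurable_snd)
  have := hh.lintegral_kernel (κ := K)
  convert! this using 2 with p
  simp [K, Kernel.prod_apply, Function.uncurry]

/-- After conditioning on the arrivals, the term depends on the gaps only through `V i`, `V j` and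
the sum of the others. The mixture then reduces it to the two-gap formula at each rate. -/
lemma lintegral_claims_pair (hV : ∀ i, Measurable (V i)) (hX : ∀ i, Measurable (X i))
    (hN : IsMixedPoisson P V L) (hdep : DependsOnlyOnGap P V X) (hind : CondIndepClaims P V X)
    (t : ℝ) {i j : ℕ} (hij : i ≠ j) {h : ℝ × ℝ → ℝ≥0∞} (hh : Measurable h) :
    ∫⁻ ω, h (X i ω, X j ω) *
        {ω | arrivalTime V (max i j + 1) ω ≤ ENNReal.ofReal t}.indicator 1 ω ∂P =
      ∫⁻ r : ℝ≥0, (∫⁻ y in Set.Icc (0 : ℝ) t, ∫⁻ v in Set.Icc (0 : ℝ) (t - y),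
        ENNReal.ofReal ((r : ℝ) ^ 2 * Real.exp (-(r * (y + v)))) *
        ((∫⁻ x, h x ∂((claimLaw P V X i y).prod (claimLaw P V X j v))) *
          poissonCountLaw r (t - y - v) (Set.Ici (max i j - 1)))) ∂L := by
  obtain ⟨K, hK, hpois, hlaw⟩ := hN
  -- The gaps up to the later of the two claims, with the two distinguished ones removed: `max i j +
  -- 1 - 2` remain.
  set F : Finset ℕ := ((Finset.range (max i j + 1)).erase i).erase j with hF
  have hi : i ∈ Finset.range (max i j + 1) := by simp
  have hj : j ∈ (Finset.range (max i j + 1)).erase i := by simp [hij.symm]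
  have hcard : F.card = max i j - 1 := by
    rw [hF, Finset.card_erase_of_mem hj, Finset.card_erase_of_mem hi, Finset.card_range]; omega
  have hA : MeasurableSet {a : ℕ → ℝ≥0∞ | a i + (a j + ∑ k ∈ F, a k) ≤ ENNReal.ofReal t} :=
    measurableSet_le (by fun_prop) measurable_const
  have hG : Measurable fun p : (ℕ → ℝ≥0∞) × ℝ × ℝ => h p.2 *
      {a : ℕ → ℝ≥0∞ | a i + (a j + ∑ k ∈ F, a k) ≤ ENNReal.ofReal t}.indicator 1 p.1 :=
    (hh.comp measurable_snd).mul ((measurable_one.indicator hA).comp measurable_fst)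
  have hH := measurable_lintegral_condDistrib_prod (P := P) (V := V) (X := X) i j hh
  have hset : ∀ ω, arrivalTime V (max i j + 1) ω = V i ω + (V j ω + ∑ k ∈ F, V k ω) := by
    intro ω
    rw [arrivalTime, Finset.add_sum_erase _ (fun k => V k ω) hj,
      Finset.add_sum_erase _ (fun k => V k ω) hi]
  have h1 := lintegral_arrival_claims hV hX hdep hind hij hG
  have h2 : ∀ a : ℕ → ℝ≥0∞, ∫⁻ x, h x *
      {a : ℕ → ℝ≥0∞ | a i + (a j + ∑ k ∈ F, a k) ≤ ENNReal.ofReal t}.indicator 1 a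
      ∂((condDistrib (X i) (V i) P (a i)).prod (condDistrib (X j) (V j) P (a j))) =
      (∫⁻ x, h x ∂((condDistrib (X i) (V i) P (a i)).prod (condDistrib (X j) (V j) P (a j)))) *
      {a : ℕ → ℝ≥0∞ | a i + (a j + ∑ k ∈ F, a k) ≤ ENNReal.ofReal t}.indicator 1 a := fun a =>
    lintegral_mul_const _ hh
  simp only [h2] at h1
  have h3 : Measurable fun a : ℕ → ℝ≥0∞ =>
      (∫⁻ x, h x ∂((condDistrib (X i) (V i) P (a i)).prod (condDistrib (X j) (V j) P (a j)))) *
      {a : ℕ → ℝ≥0∞ | a i + (a j + ∑ k ∈ F, a k) ≤ ENNReal.ofReal t}.indicator 1 a :=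
    (hH.comp (g := Function.uncurry fun b c : ℝ≥0∞ =>
      ∫⁻ x, h x ∂((condDistrib (X i) (V i) P b).prod (condDistrib (X j) (V j) P c)))
      (f := fun a : ℕ → ℝ≥0∞ => (a i, a j))
      ((measurable_pi_apply i).prodMk (measurable_pi_apply j))).mul
      (measurable_one.indicator hA)
  rw [hlaw, Measure.lintegral_bind K.aemeasurable h3.aemeasurable] at h1
  refine Eq.trans ?_ (h1.trans (lintegral_congr fun r => ?_))
  · refine lintegral_congr fun ω => ?_
    simp only [Set.indicator_apply, Set.mem_ofPred_eq, hset, Pi.one_apply]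
  · have := lintegral_gap_pair_mul_sum_le (μ := K r) (r := r)
      (Y := fun (k : ℕ) (a : ℕ → ℝ≥0∞) => a k)
      (fun k => measurable_pi_apply k) (hpois r).1 (hpois r).2 (F := F) hij
      (by simp [hF]) (by simp [hF]) t hH
    rw [hcard] at this
    exact this

lemma lintegral_claim (hV : ∀ i, Measurable (V i)) (hX : ∀ i, Measurable (X i))
    (hN : IsMixedPoisson P V L) (hdep : DependsOnlyOnGap P V X) (hind : CondIndepClaims P V X)
    (t : ℝ) (i : ℕ) {f : ℝ → ℝ≥0∞} (hf : Measurable f) :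
    ∫⁻ ω, f (X i ω) * {ω | arrivalTime V (i + 1) ω ≤ ENNReal.ofReal t}.indicator 1 ω ∂P =
      ∫⁻ r : ℝ≥0, (∫⁻ v in Set.Icc (0 : ℝ) t, ENNReal.ofReal (r * Real.exp (-(r * v))) *
        ((∫⁻ x, f x ∂(claimLaw P V X i v)) *
          poissonCountLaw r (t - v) (Set.Ici i))) ∂L := by
  obtain ⟨K, hK, hpois, hlaw⟩ := hN
  have hA : MeasurableSet {a : ℕ → ℝ≥0∞ |
      a i + ∑ k ∈ Finset.range i, a k ≤ ENNReal.ofReal t} :=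
    measurableSet_le (by fun_prop) measurable_const
  have hG : Measurable fun p : (ℕ → ℝ≥0∞) × ℝ × ℝ => f p.2.1 *
      {a : ℕ → ℝ≥0∞ | a i + ∑ k ∈ Finset.range i, a k ≤ ENNReal.ofReal t}.indicator 1 p.1 :=
    (hf.comp (measurable_fst.comp measurable_snd)).mul
      ((measurable_one.indicator hA).comp measurable_fst)
  have hH : Measurable fun b : ℝ≥0∞ => ∫⁻ x, f x ∂(condDistrib (X i) (V i) P b) :=
    hf.lintegral_kernel
  -- The two-claim law is reused with claim `i + 1` as a dummy partner; its conditional law has mass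
  -- 1 and integrates out.
  have h1 := lintegral_arrival_claims hV hX hdep hind i.succ_ne_self.symm hG
  have h2 : ∀ a : ℕ → ℝ≥0∞, ∫⁻ x : ℝ × ℝ, f x.1 *
      {a : ℕ → ℝ≥0∞ | a i + ∑ k ∈ Finset.range i, a k ≤ ENNReal.ofReal t}.indicator 1 a
      ∂((condDistrib (X i) (V i) P (a i)).prod
        (condDistrib (X (i + 1)) (V (i + 1)) P (a (i + 1)))) =
      (∫⁻ x, f x ∂(condDistrib (X i) (V i) P (a i))) *
      {a : ℕ → ℝ≥0∞ | a i + ∑ k ∈ Finset.range i, a k ≤ ENNReal.ofReal t}.indicator 1 a := by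
    intro a
    have hf1 : Measurable fun x : ℝ × ℝ => f x.1 := hf.comp measurable_fst
    rw [lintegral_mul_const _ hf1, lintegral_prod _ hf1.aemeasurable]
    simp
  simp only [Nat.succ_eq_add_one, h2] at h1
  have h3 : Measurable fun a : ℕ → ℝ≥0∞ =>
      (∫⁻ x, f x ∂(condDistrib (X i) (V i) P (a i))) *
      {a : ℕ → ℝ≥0∞ | a i + ∑ k ∈ Finset.range i, a k ≤ ENNReal.ofReal t}.indicator 1 a :=
    (hH.comp (measurable_pi_apply i)).mul (measurable_one.indicator hA)
  rw [hlaw, Measure.lintegral_bind K.aemeasurable h3.aemeasurable] at h1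
  refine Eq.trans ?_ (h1.trans (lintegral_congr fun r => ?_))
  · refine lintegral_congr fun ω => ?_
    simp only [Set.indicator_apply, Set.mem_ofPred_eq, arrivalTime, Finset.sum_range_succ,
      add_comm, Pi.one_apply]
  · have := lintegral_gap_mul_sum_le (μ := K r) (r := r)
      (Y := fun (k : ℕ) (a : ℕ → ℝ≥0∞) => a k)
      (fun k => measurable_pi_apply k) (hpois r).1 (hpois r).2 (F := Finset.range i) (i := i)
      (by simp) t hH
    rw [Finset.card_range] at this
    exact this

end Mixed

/-! ### The triangle of time pairs, and random sums as series over fixed indices. -/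

/-- The triangle of pairs of nonnegative times with sum at most `t`. -/
def timeTriangle (t : ℝ) : Set (ℝ × ℝ) := {q | 0 ≤ q.1 ∧ 0 ≤ q.2 ∧ q.1 + q.2 ≤ t}

lemma measurableSet_timeTriangle (t : ℝ) : MeasurableSet (timeTriangle t) :=
  (measurableSet_le measurable_const measurable_fst).inter
    ((measurableSet_le measurable_const measurable_snd).inter
      (measurableSet_le (measurable_fst.add measurable_snd) measurable_const))

lemma mem_timeTriangle {t y v : ℝ} :
    (y, v) ∈ timeTriangle t ↔ y ∈ Set.Icc 0 t ∧ v ∈ Set.Icc 0 (t - y) := by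
  simp only [timeTriangle, Set.mem_ofPred_eq, Set.mem_Icc]
  constructor
  · rintro ⟨h1, h2, h3⟩
    exact ⟨⟨h1, by linarith⟩, h2, by linarith⟩
  · rintro ⟨⟨h1, h2⟩, h3, h4⟩
    exact ⟨h1, h3, by linarith⟩

lemma setLIntegral_timeTriangle (t : ℝ) {f : ℝ × ℝ → ℝ≥0∞} (hf : Measurable f) :
    ∫⁻ q in timeTriangle t, f q =
      ∫⁻ y in Set.Icc (0 : ℝ) t, ∫⁻ v in Set.Icc (0 : ℝ) (t - y), f (y, v) := by
  rw [← lintegral_indicator (measurableSet_timeTriangle t), Measure.volume_eq_prod,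
    lintegral_prod _ (hf.indicator (measurableSet_timeTriangle t)).aemeasurable,
    ← lintegral_indicator measurableSet_Icc]
  refine lintegral_congr fun y => ?_
  by_cases hy : y ∈ Set.Icc 0 t
  · rw [Set.indicator_of_mem hy, ← lintegral_indicator measurableSet_Icc]
    refine lintegral_congr fun v => ?_
    by_cases hv : v ∈ Set.Icc 0 (t - y)
    · rw [Set.indicator_of_mem hv, Set.indicator_of_mem (mem_timeTriangle.2 ⟨hy, hv⟩)]
    · rw [Set.indicator_of_notMem hv,
        Set.indicator_of_notMem fun h => hv (mem_timeTriangle.1 h).2]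
  · rw [Set.indicator_of_notMem hy]
    refine (lintegral_congr fun v => ?_).trans lintegral_zero
    exact Set.indicator_of_notMem (fun h => hy (mem_timeTriangle.1 h).1) f

lemma sum_range_eq_tsum (N : ℕ) (b : ℕ → ℝ≥0∞) :
    ∑ i ∈ Finset.range N, b i = ∑' i, b i * (Set.Iio N).indicator 1 i := by
  rw [tsum_eq_sum (s := Finset.range N) fun i hi => by
    simp only [Finset.mem_range] at hi; simp [hi]]
  exact Finset.sum_congr rfl fun i hi => by simp [Finset.mem_range.1 hi]

/-- Both indices lie below `N` exactly when their maximum does. The series has index sets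
independent of `N`, so it can be interchanged with an expectation. -/
lemma sum_range_erase_eq_tsum (N : ℕ) (b : ℕ → ℕ → ℝ≥0∞) :
    ∑ i ∈ Finset.range N, ∑ j ∈ (Finset.range N).erase i, b i j =
      ∑' i, ∑' j, if i = j then 0 else b i j * (Set.Iio N).indicator 1 (max i j) := by
  rw [tsum_eq_sum (s := Finset.range N)]
  · refine Finset.sum_congr rfl fun i hi => ?_
    rw [tsum_eq_sum (s := (Finset.range N).erase i)]
    · refine Finset.sum_congr rfl fun j hj => ?_
      simp only [Finset.mem_erase, Finset.mem_range] at hi hj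
      simp [hi, hj.2, hj.1.symm]
    · intro j hj
      simp only [Finset.mem_erase, Finset.mem_range, not_and] at hj
      by_cases h : i = j
      · simp [h]
      · simp [h, hj (Ne.symm h)]
  · intro i hi
    simp only [Finset.mem_range] at hi
    simp [hi]

lemma lintegral_sum_range_succ (ρ : Measure ℕ) (b : ℕ → ℝ≥0∞) :
    ∫⁻ n, ∑ i ∈ Finset.range (n + 1), b i ∂ρ = ∑' i, b i * ρ (Set.Ici i) := by
  simp_rw [sum_range_eq_tsum]
  rw [lintegral_tsum fun i => Measurable.of_discrete.aemeasurable]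
  refine tsum_congr fun i => ?_
  rw [lintegral_const_mul _ .of_discrete, ← lintegral_indicator_one .of_discrete]
  congr 2 with n
  simp [Set.indicator_apply]

/-- The pair `i ≠ j` contributes when `max i j < n + 2`, that is `max i j - 1 ≤ n`; this matches the
number of gaps left over in `lintegral_claims_pair`. -/
lemma lintegral_sum_range_add_two_erase (ρ : Measure ℕ) (b : ℕ → ℕ → ℝ≥0∞) :
    ∫⁻ n, ∑ i ∈ Finset.range (n + 2), ∑ j ∈ (Finset.range (n + 2)).erase i, b i j ∂ρ =
      ∑' i, ∑' j, if i = j then 0 else b i j * ρ (Set.Ici (max i j - 1)) := by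
  simp_rw [sum_range_erase_eq_tsum]
  rw [lintegral_tsum fun i => Measurable.of_discrete.aemeasurable]
  refine tsum_congr fun i => ?_
  rw [lintegral_tsum fun i => Measurable.of_discrete.aemeasurable]
  refine tsum_congr fun j => ?_
  by_cases hij : i = j
  · simp [hij]
  · simp only [hij, if_false]
    rw [lintegral_const_mul _ .of_discrete, ← lintegral_indicator_one .of_discrete]
    congr 2 with n
    have : max i j < n + 2 ↔ max i j - 1 ≤ n := by omega
    simp only [Set.indicator_apply, Set.mem_Iio, Set.mem_Ici, this]
    rfl

lemma measurable_lintegral_poissonCountLaw {β : Type*} [MeasurableSpace β] {f : β → ℝ≥0}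
    {g : β → ℝ} (hf : Measurable f) (hg : Measurable g) {u : β → ℕ → ℝ≥0∞}
    (hu : ∀ n, Measurable fun b => u b n) :
    Measurable fun b => ∫⁻ n, u b n ∂(poissonCountLaw (f b) (g b)) := by
  simp_rw [lintegral_countable']
  exact Measurable.tsum fun n => (hu n).mul (measurable_poissonCountLaw_apply hf hg {n})

/-! ### Expectations of the diagonal and off-diagonal sums in `[0, ∞]`. -/

section Mixed

variable {Ω : Type*} [MeasurableSpace Ω] {P : Measure Ω} [IsProbabilityMeasure P]
  {V : ℕ → Ω → ℝ≥0∞} {X : ℕ → Ω → ℝ}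

instance (i : ℕ) (v : ℝ) : IsProbabilityMeasure (claimLaw P V X i v) := by
  unfold claimLaw; infer_instance

lemma measurable_lintegral_claimLaw (i : ℕ) {f : ℝ → ℝ≥0∞} (hf : Measurable f) :
    Measurable fun v => ∫⁻ x, f x ∂(claimLaw P V X i v) :=
  (hf.lintegral_kernel (κ := condDistrib (X i) (V i) P)).comp ENNReal.measurable_ofReal

lemma measurable_lintegral_claimLaw_prod (i j : ℕ) {h : ℝ × ℝ → ℝ≥0∞} (hh : Measurable h) :
    Measurable fun q : ℝ × ℝ =>
      ∫⁻ x, h x ∂((claimLaw P V X i q.1).prod (claimLaw P V X j q.2)) :=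
  (measurable_lintegral_condDistrib_prod (P := P) (V := V) (X := X) i j hh).comp
    (f := fun q : ℝ × ℝ => (ENNReal.ofReal q.1, ENNReal.ofReal q.2)) (by fun_prop)

lemma measurable_lintegral_sum_claimLaw (t : ℝ) {f : ℝ → ℝ≥0∞} (hf : Measurable f) :
    Measurable fun p : ℝ≥0 × ℝ => ∫⁻ n, ∑ i ∈ Finset.range (n + 1),
      ∫⁻ x, f x ∂(claimLaw P V X i p.2) ∂(poissonCountLaw p.1 (t - p.2)) := by
  refine measurable_lintegral_poissonCountLaw measurable_fst (by fun_prop) fun n => ?_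
  exact Finset.measurable_fun_sum _ fun i _ =>
    (measurable_lintegral_claimLaw i hf).comp measurable_snd

lemma measurable_lintegral_sum_claimLaw_prod (t : ℝ) {h : ℝ × ℝ → ℝ≥0∞} (hh : Measurable h) :
    Measurable fun p : ℝ≥0 × ℝ × ℝ => ∫⁻ n,
      ∑ i ∈ Finset.range (n + 2), ∑ j ∈ (Finset.range (n + 2)).erase i,
        ∫⁻ x, h x ∂((claimLaw P V X i p.2.1).prod (claimLaw P V X j p.2.2))
        ∂(poissonCountLaw p.1 (t - p.2.1 - p.2.2)) := by
  refine measurable_lintegral_poissonCountLaw measurable_fst (by fun_prop) fun n => ?_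
  exact Finset.measurable_fun_sum _ fun i _ => Finset.measurable_fun_sum _ fun j _ =>
    (measurable_lintegral_claimLaw_prod i j hh).comp measurable_snd

variable {L : Measure ℝ≥0}

lemma lintegral_sum_claims (hV : ∀ i, Measurable (V i)) (hX : ∀ i, Measurable (X i))
    (hN : IsMixedPoisson P V L) (hdep : DependsOnlyOnGap P V X) (hind : CondIndepClaims P V X)
    {t : ℝ} (ht : 0 ≤ t) {f : ℝ → ℝ≥0∞} (hf : Measurable f) :
    ∫⁻ ω, ∑ i ∈ Finset.range (claimCount V t ω), f (X i ω) ∂P =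
      ∫⁻ p : ℝ≥0 × ℝ, ENNReal.ofReal (p.1 * Real.exp (-(p.1 * p.2))) *
        ∫⁻ n, ∑ i ∈ Finset.range (n + 1), ∫⁻ x, f x ∂(claimLaw P V X i p.2)
          ∂(poissonCountLaw p.1 (t - p.2)) ∂(L.prod (volume.restrict (Set.Icc 0 t))) := by
  have hT : ∀ n, MeasurableSet {ω | arrivalTime V n ω ≤ ENNReal.ofReal t} := fun n =>
    measurableSet_le (measurable_arrivalTime hV n) measurable_const
  have h1 : ∫⁻ ω, ∑ i ∈ Finset.range (claimCount V t ω), f (X i ω) ∂P = ∫⁻ ω, ∑' i, f (X i ω) *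
      {ω | arrivalTime V (i + 1) ω ≤ ENNReal.ofReal t}.indicator 1 ω ∂P := by
    refine lintegral_congr_ae ?_
    filter_upwards [ae_exists_lt_arrivalTime hV hN ht] with ω hω
    rw [sum_range_eq_tsum]
    refine tsum_congr fun i => ?_
    simp only [Set.indicator_apply, Set.mem_Iio, Set.mem_ofPred_eq, lt_claimCount_iff, hω,
      true_and, Pi.one_apply]
  have hm1 : ∀ i, Measurable fun ω => f (X i ω) *
      {ω | arrivalTime V (i + 1) ω ≤ ENNReal.ofReal t}.indicator 1 ω := fun i =>
    (hf.comp (hX i)).mul (measurable_one.indicator (hT _))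
  rw [h1, lintegral_tsum fun i => (hm1 i).aemeasurable]
  simp_rw [lintegral_sum_range_succ, ← ENNReal.tsum_mul_left]
  have hm : ∀ i, Measurable fun p : ℝ≥0 × ℝ =>
      ENNReal.ofReal (p.1 * Real.exp (-(p.1 * p.2))) * ((∫⁻ x, f x ∂(claimLaw P V X i p.2)) *
        poissonCountLaw p.1 (t - p.2) (Set.Ici i)) := fun i =>
    Measurable.mul (by fun_prop) (((measurable_lintegral_claimLaw i hf).comp measurable_snd).mul
      (measurable_poissonCountLaw_apply measurable_fst (by fun_prop) _))
  rw [lintegral_tsum fun i => (hm i).aemeasurable]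
  refine tsum_congr fun i => ?_
  rw [lintegral_claim hV hX hN hdep hind t i hf, lintegral_prod _ (hm i).aemeasurable]

/-- Tonelli, used on both sides: each side is a double series over `i` and `j`, and
`lintegral_claims_pair` matches the terms. Arbitrary `h` allows the positive part, negative part and
absolute value of the product. -/
lemma lintegral_sum_claims_pair (hV : ∀ i, Measurable (V i)) (hX : ∀ i, Measurable (X i))
    (hN : IsMixedPoisson P V L) (hdep : DependsOnlyOnGap P V X) (hind : CondIndepClaims P V X)
    {t : ℝ} (ht : 0 ≤ t) {h : ℝ × ℝ → ℝ≥0∞} (hh : Measurable h) :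
    ∫⁻ ω, ∑ i ∈ Finset.range (claimCount V t ω),
        ∑ j ∈ (Finset.range (claimCount V t ω)).erase i, h (X i ω, X j ω) ∂P =
      ∫⁻ p : ℝ≥0 × ℝ × ℝ,
        ENNReal.ofReal ((p.1 : ℝ) ^ 2 * Real.exp (-(p.1 * (p.2.1 + p.2.2)))) *
        ∫⁻ n, ∑ i ∈ Finset.range (n + 2), ∑ j ∈ (Finset.range (n + 2)).erase i,
          ∫⁻ x, h x ∂((claimLaw P V X i p.2.1).prod (claimLaw P V X j p.2.2))
          ∂(poissonCountLaw p.1 (t - p.2.1 - p.2.2))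
        ∂(L.prod (volume.restrict (timeTriangle t))) := by
  have hT : ∀ n, MeasurableSet {ω | arrivalTime V n ω ≤ ENNReal.ofReal t} := fun n =>
    measurableSet_le (measurable_arrivalTime hV n) measurable_const
  have h1 : ∫⁻ ω, ∑ i ∈ Finset.range (claimCount V t ω),
        ∑ j ∈ (Finset.range (claimCount V t ω)).erase i, h (X i ω, X j ω) ∂P =
      ∫⁻ ω, ∑' i, ∑' j, (if i = j then 0 else h (X i ω, X j ω) *
      {ω | arrivalTime V (max i j + 1) ω ≤ ENNReal.ofReal t}.indicator 1 ω) ∂P := by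
    refine lintegral_congr_ae ?_
    filter_upwards [ae_exists_lt_arrivalTime hV hN ht] with ω hω
    rw [sum_range_erase_eq_tsum]
    refine tsum_congr fun i => tsum_congr fun j => ?_
    simp only [Set.indicator_apply, Set.mem_Iio, Set.mem_ofPred_eq, lt_claimCount_iff, hω,
      true_and, Pi.one_apply]
  have hm1 : ∀ i j, Measurable fun ω => if i = j then 0 else h (X i ω, X j ω) *
      {ω | arrivalTime V (max i j + 1) ω ≤ ENNReal.ofReal t}.indicator 1 ω := by
    intro i j
    by_cases hij : i = j
    · simp [hij]
    · simp only [hij, if_false]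
      exact (hh.comp ((hX i).prodMk (hX j))).mul (measurable_one.indicator (hT _))
  have hm : ∀ i j, Measurable fun p : ℝ≥0 × ℝ × ℝ =>
      ENNReal.ofReal ((p.1 : ℝ) ^ 2 * Real.exp (-(p.1 * (p.2.1 + p.2.2)))) *
      (if i = j then 0 else
        (∫⁻ x, h x ∂((claimLaw P V X i p.2.1).prod (claimLaw P V X j p.2.2))) *
        poissonCountLaw p.1 (t - p.2.1 - p.2.2) (Set.Ici (max i j - 1))) := by
    intro i j
    by_cases hij : i = j
    · simp [hij]
    · simp only [hij, if_false]
      exact Measurable.mul (by fun_prop)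
        (((measurable_lintegral_claimLaw_prod i j hh).comp measurable_snd).mul
        (measurable_poissonCountLaw_apply measurable_fst (by fun_prop) _))
  rw [h1, lintegral_tsum fun i => (Measurable.tsum fun j => hm1 i j).aemeasurable]
  simp_rw [lintegral_sum_range_add_two_erase, ← ENNReal.tsum_mul_left]
  rw [lintegral_tsum fun i => (Measurable.tsum fun j => hm i j).aemeasurable]
  refine tsum_congr fun i => ?_
  rw [lintegral_tsum fun j => (hm1 i j).aemeasurable,
    lintegral_tsum fun j => (hm i j).aemeasurable]
  refine tsum_congr fun j => ?_
  rw [lintegral_prod _ (hm i j).aemeasurable]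
  by_cases hij : i = j
  · simp [hij]
  · have hm' := hm i j
    simp only [hij, if_false] at hm' ⊢
    rw [lintegral_claims_pair hV hX hN hdep hind t hij hh]
    refine lintegral_congr fun r => ?_
    exact (setLIntegral_timeTriangle t (hm'.comp (measurable_prodMk_left (x := r)))).symm

end Mixed

/-! ### Real conditional moments compared with their `[0, ∞]` versions. -/

lemma sq_sum_eq_sum_sq_add_sum_erase {R : Type*} [CommSemiring R] (s : Finset ℕ) (x : ℕ → R) :
    (∑ i ∈ s, x i) ^ 2 = ∑ i ∈ s, x i ^ 2 + ∑ i ∈ s, ∑ j ∈ s.erase i, x i * x j := by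
  rw [sq, Finset.sum_mul_sum, ← Finset.sum_add_distrib]
  exact Finset.sum_congr rfl fun i hi => by rw [← Finset.add_sum_erase s _ hi, sq]

section Conditional

variable {Ω : Type*} [MeasurableSpace Ω] {P : Measure Ω} [IsProbabilityMeasure P]
  {V : ℕ → Ω → ℝ≥0∞} {X : ℕ → Ω → ℝ}

lemma condSecond_eq_toReal (i : ℕ) (v : ℝ) :
    condSecond P V X i v = (condSecondENN P V X i v).toReal :=
  integral_eq_lintegral_of_nonneg_ae (Filter.Eventually.of_forall fun x => sq_nonneg x)
    (by fun_prop)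

lemma Theta_eq_toReal {n : ℕ} {v : ℝ} (h : ThetaENN P V X n v ≠ ∞) :
    Theta P V X n v = (ThetaENN P V X n v).toReal := by
  rw [Theta, ThetaENN, ENNReal.toReal_sum fun i hi => ENNReal.sum_ne_top.1 h i hi]
  exact Finset.sum_congr rfl fun i _ => condSecond_eq_toReal i v

lemma integrable_Theta {ρ : Measure ℕ} {v : ℝ} (h : ∫⁻ n, ThetaENN P V X (n + 1) v ∂ρ ≠ ∞) :
    Integrable (fun n => Theta P V X (n + 1) v) ρ ∧
      ∫ n, Theta P V X (n + 1) v ∂ρ = (∫⁻ n, ThetaENN P V X (n + 1) v ∂ρ).toReal := by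
  have hfin : ∀ᵐ n ∂ρ, ThetaENN P V X (n + 1) v < ∞ := ae_lt_top .of_discrete h
  have heq : (fun n => (ThetaENN P V X (n + 1) v).toReal) =ᵐ[ρ]
      fun n => Theta P V X (n + 1) v := hfin.mono fun n hn => (Theta_eq_toReal hn.ne).symm
  refine ⟨(integrable_toReal_of_lintegral_ne_top Measurable.of_discrete.aemeasurable h).congr heq,
    ?_⟩
  rw [← integral_congr_ae heq, integral_toReal Measurable.of_discrete.aemeasurable hfin]

/-- The expectation is a series whose `i`-th term is the conditional second moment times a Poisson
tail. For `r > 0` and `s > 0` every tail is positive, so an infinite moment of any claim would make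
the series infinite. -/
lemma condSecondENN_ne_top {r : ℝ≥0} {s v : ℝ} (hr : 0 < r) (hs : 0 < s)
    (h : ∫⁻ n, ThetaENN P V X (n + 1) v ∂(poissonCountLaw r s) ≠ ∞) (i : ℕ) :
    condSecondENN P V X i v ≠ ∞ := by
  have h1 : ∫⁻ n, ThetaENN P V X (n + 1) v ∂(poissonCountLaw r s) =
    ∑' i, condSecondENN P V X i v * poissonCountLaw r s (Set.Ici i) := lintegral_sum_range_succ _ _
  rw [h1] at h
  have h2 := ENNReal.ne_top_of_tsum_ne_top h i
  refine fun htop => h2 ?_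
  rw [htop, ENNReal.top_mul]
  refine (pos_iff_ne_zero.1 ?_)
  refine lt_of_lt_of_le ?_ (measure_mono (Set.singleton_subset_iff.2 (Set.mem_Ici.2 le_rfl)))
  rw [poissonCountLaw_singleton r hs.le, ENNReal.ofReal_pos]
  have : (0 : ℝ) < r := hr
  positivity

lemma integrable_claimLaw_of_condSecondENN_ne_top {i : ℕ} {v : ℝ}
    (h : condSecondENN P V X i v ≠ ∞) :
    Integrable (fun x : ℝ => x) (claimLaw P V X i v) ∧
      Integrable (fun x : ℝ => x ^ 2) (claimLaw P V X i v) := by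
  have h2 : Integrable (fun x : ℝ => x ^ 2) (claimLaw P V X i v) := by
    refine ⟨by fun_prop, ?_⟩
    rw [hasFiniteIntegral_iff_ofReal (Filter.Eventually.of_forall fun x => sq_nonneg x)]
    exact h.lt_top
  exact ⟨((memLp_two_iff_integrable_sq (by fun_prop)).2 h2).integrable one_le_two, h2⟩

variable (P V X) in
/-- The sum over ordered pairs `i ≠ j` among the first `n` claims of the conditional expectation
of `h (X i, X j)` given `V i = y` and `V j = v`. -/
noncomputable def condPairSum (h : ℝ × ℝ → ℝ≥0∞) (n : ℕ) (y v : ℝ) : ℝ≥0∞ :=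
  ∑ i ∈ Finset.range n, ∑ j ∈ (Finset.range n).erase i,
    ∫⁻ x, h x ∂((claimLaw P V X i y).prod (claimLaw P V X j v))

lemma condPairSum_mono {h h' : ℝ × ℝ → ℝ≥0∞} (hh : ∀ x, h x ≤ h' x) (n : ℕ) (y v : ℝ) :
    condPairSum P V X h n y v ≤ condPairSum P V X h' n y v :=
  Finset.sum_le_sum fun _ _ => Finset.sum_le_sum fun _ _ => lintegral_mono hh

lemma condPairSum_mul (n : ℕ) (y v : ℝ) :
    condPairSum P V X (fun x => ENNReal.ofReal x.1 * ENNReal.ofReal x.2) n y v =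
      UpsilonENN P V X n y v :=
  Finset.sum_congr rfl fun _ _ => Finset.sum_congr rfl fun _ _ =>
    lintegral_prod_mul ENNReal.measurable_ofReal.aemeasurable
      ENNReal.measurable_ofReal.aemeasurable

lemma ofReal_le_ofReal_abs (a : ℝ) : ENNReal.ofReal a ≤ ENNReal.ofReal |a| :=
  ENNReal.ofReal_le_ofReal (le_abs_self a)

lemma ofReal_neg_le_ofReal_abs (a : ℝ) : ENNReal.ofReal (-a) ≤ ENNReal.ofReal |a| :=
  ENNReal.ofReal_le_ofReal (neg_le_abs a)

/-- Under the product of the conditional laws, the integral of `x.1 * x.2` is the product of the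
means. Splitting the product, rather than each factor, leaves just two nonnegative functions. -/
lemma Upsilon_eq_toReal_sub {n : ℕ} {y v : ℝ}
    (h : condPairSum P V X (fun x => ENNReal.ofReal |x.1 * x.2|) n y v ≠ ∞) :
    Upsilon P V X n y v =
      (condPairSum P V X (fun x => ENNReal.ofReal (x.1 * x.2)) n y v).toReal -
      (condPairSum P V X (fun x => ENNReal.ofReal (-(x.1 * x.2))) n y v).toReal := by
  have hfin : ∀ i ∈ Finset.range n, ∀ j ∈ (Finset.range n).erase i,
      ∫⁻ x, ENNReal.ofReal |x.1 * x.2| ∂((claimLaw P V X i y).prod (claimLaw P V X j v)) ≠ ∞ :=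
    fun i hi j hj => ENNReal.sum_ne_top.1 (ENNReal.sum_ne_top.1 h i hi) j hj
  have htoReal : ∀ {g : ℝ × ℝ → ℝ≥0∞}, (∀ x, g x ≤ ENNReal.ofReal |x.1 * x.2|) →
      (condPairSum P V X g n y v).toReal = ∑ i ∈ Finset.range n, ∑ j ∈ (Finset.range n).erase i,
        (∫⁻ x, g x ∂((claimLaw P V X i y).prod (claimLaw P V X j v))).toReal := by
    intro g hg
    have hfin' : ∀ i ∈ Finset.range n, ∀ j ∈ (Finset.range n).erase i,
        ∫⁻ x, g x ∂((claimLaw P V X i y).prod (claimLaw P V X j v)) ≠ ∞ := fun i hi j hj =>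
      ne_top_of_le_ne_top (hfin i hi j hj) (lintegral_mono hg)
    rw [condPairSum, ENNReal.toReal_sum fun i hi => ENNReal.sum_ne_top.2 (hfin' i hi)]
    exact Finset.sum_congr rfl fun i hi => ENNReal.toReal_sum (hfin' i hi)
  rw [htoReal fun x => ofReal_le_ofReal_abs _, htoReal fun x => ofReal_neg_le_ofReal_abs _,
    ← Finset.sum_sub_distrib, Upsilon]
  refine Finset.sum_congr rfl fun i hi => ?_
  rw [← Finset.sum_sub_distrib]
  refine Finset.sum_congr rfl fun j hj => ?_
  have hint : Integrable (fun x : ℝ × ℝ => x.1 * x.2)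
      ((claimLaw P V X i y).prod (claimLaw P V X j v)) := by
    refine ⟨by fun_prop, ?_⟩
    rw [hasFiniteIntegral_iff_norm]
    exact (hfin i hi j hj).lt_top
  rw [← integral_eq_lintegral_pos_part_sub_lintegral_neg_part hint]
  exact (integral_prod_mul (fun x : ℝ => x) (fun x : ℝ => x)).symm

lemma integrable_Upsilon {ρ : Measure ℕ} {y v : ℝ}
    (h : ∫⁻ n, condPairSum P V X (fun x => ENNReal.ofReal |x.1 * x.2|) (n + 2) y v ∂ρ ≠ ∞) :
    Integrable (fun n => Upsilon P V X (n + 2) y v) ρ ∧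
      ∫ n, Upsilon P V X (n + 2) y v ∂ρ =
      (∫⁻ n, condPairSum P V X (fun x => ENNReal.ofReal (x.1 * x.2)) (n + 2) y v ∂ρ).toReal -
      (∫⁻ n, condPairSum P V X (fun x => ENNReal.ofReal (-(x.1 * x.2))) (n + 2) y v ∂ρ).toReal := by
  have hfin : ∀ᵐ n ∂ρ, condPairSum P V X (fun x => ENNReal.ofReal |x.1 * x.2|) (n + 2) y v < ∞ :=
    ae_lt_top .of_discrete h
  have hpart : ∀ {g : ℝ × ℝ → ℝ≥0∞}, (∀ x, g x ≤ ENNReal.ofReal |x.1 * x.2|) →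
      Integrable (fun n => (condPairSum P V X g (n + 2) y v).toReal) ρ ∧
      ∫ n, (condPairSum P V X g (n + 2) y v).toReal ∂ρ =
        (∫⁻ n, condPairSum P V X g (n + 2) y v ∂ρ).toReal := by
    intro g hg
    refine ⟨integrable_toReal_of_lintegral_ne_top Measurable.of_discrete.aemeasurable
      (ne_top_of_le_ne_top h (lintegral_mono fun n => condPairSum_mono hg _ _ _)),
      integral_toReal Measurable.of_discrete.aemeasurable
        (hfin.mono fun n hn => (condPairSum_mono hg _ _ _).trans_lt hn)⟩
  have hp := hpart fun x => ofReal_le_ofReal_abs (x.1 * x.2)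
  have hn := hpart fun x => ofReal_neg_le_ofReal_abs (x.1 * x.2)
  have heq : (fun n => (condPairSum P V X (fun x => ENNReal.ofReal (x.1 * x.2)) (n + 2) y v).toReal
      - (condPairSum P V X (fun x => ENNReal.ofReal (-(x.1 * x.2))) (n + 2) y v).toReal) =ᵐ[ρ]
      fun n => Upsilon P V X (n + 2) y v :=
    hfin.mono fun n hn => (Upsilon_eq_toReal_sub hn.ne).symm
  refine ⟨(hp.1.sub hn.1).congr heq, ?_⟩
  rw [← integral_congr_ae heq, integral_sub hp.1 hn.1, hp.2, hn.2]

end Conditional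

lemma setIntegral_timeTriangle {t : ℝ} (ht : 0 ≤ t) {f : ℝ × ℝ → ℝ}
    (hf : IntegrableOn f (timeTriangle t)) :
    ∫ q in timeTriangle t, f q = ∫ y in (0 : ℝ)..t, ∫ v in (0 : ℝ)..(t - y), f (y, v) := by
  have hf' := (integrable_indicator_iff (measurableSet_timeTriangle t)).2 hf
  rw [Measure.volume_eq_prod] at hf'
  rw [← integral_indicator (measurableSet_timeTriangle t), Measure.volume_eq_prod,
    integral_prod _ hf', intervalIntegral.integral_of_le ht, ← integral_Icc_eq_integral_Ioc,
    ← integral_indicator measurableSet_Icc]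
  congr with y
  by_cases hy : y ∈ Set.Icc 0 t
  · rw [Set.indicator_of_mem hy, intervalIntegral.integral_of_le (sub_nonneg.2 hy.2),
      ← integral_Icc_eq_integral_Ioc, ← integral_indicator measurableSet_Icc]
    congr with v
    by_cases hv : v ∈ Set.Icc 0 (t - y)
    · rw [Set.indicator_of_mem hv, Set.indicator_of_mem (mem_timeTriangle.2 ⟨hy, hv⟩)]
    · rw [Set.indicator_of_notMem hv,
        Set.indicator_of_notMem fun h => hv (mem_timeTriangle.1 h).2]
  · rw [Set.indicator_of_notMem hy]
    refine (integral_congr_ae (Filter.Eventually.of_forall fun v => ?_)).trans (integral_zero _ _)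
    exact Set.indicator_of_notMem (fun h => hy (mem_timeTriangle.1 h).1) f

lemma ofReal_sq_sum {s : Finset ℕ} {x : ℕ → ℝ} (hx : ∀ i, 0 ≤ x i) :
    ENNReal.ofReal ((∑ i ∈ s, x i) ^ 2) = ∑ i ∈ s, ENNReal.ofReal (x i ^ 2) +
      ∑ i ∈ s, ∑ j ∈ s.erase i, ENNReal.ofReal (x i * x j) := by
  rw [sq_sum_eq_sum_sq_add_sum_erase, ENNReal.ofReal_add
    (Finset.sum_nonneg fun i _ => sq_nonneg _)
    (Finset.sum_nonneg fun i _ => Finset.sum_nonneg fun j _ => mul_nonneg (hx i) (hx j)),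
    ENNReal.ofReal_sum_of_nonneg fun i _ => sq_nonneg _,
    ENNReal.ofReal_sum_of_nonneg fun i _ =>
      Finset.sum_nonneg fun j _ => mul_nonneg (hx i) (hx j)]
  congr 1
  exact Finset.sum_congr rfl fun i _ =>
    ENNReal.ofReal_sum_of_nonneg fun j _ => mul_nonneg (hx i) (hx j)

/-! ### Passing from weighted `[0, ∞]` integrals to real integrals. -/

section Weighted

variable {α : Type*} [MeasurableSpace α] {μ : Measure α} {w : α → ℝ} {I : α → ℝ≥0∞}

lemma ae_eq_zero_or_lt_top_of_lintegral_ofReal_mul (hw : Measurable w) (hI : Measurable I)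
    (hw0 : ∀ a, 0 ≤ w a) (h : ∫⁻ a, ENNReal.ofReal (w a) * I a ∂μ ≠ ∞) :
    ∀ᵐ a ∂μ, w a = 0 ∨ I a < ∞ := by
  filter_upwards [ae_lt_top (by fun_prop) h] with a ha
  by_contra! hcon
  have hpos : 0 < w a := lt_of_le_of_ne (hw0 a) hcon.1.symm
  rw [top_le_iff.1 hcon.2, ENNReal.mul_top (ENNReal.ofReal_pos.2 hpos).ne'] at ha
  exact ha.ne rfl

lemma integrable_mul_toReal (hw : Measurable w) (hI : Measurable I) (hw0 : ∀ a, 0 ≤ w a)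
    (h : ∫⁻ a, ENNReal.ofReal (w a) * I a ∂μ ≠ ∞) :
    Integrable (fun a => w a * (I a).toReal) μ ∧
      ∫ a, w a * (I a).toReal ∂μ = (∫⁻ a, ENNReal.ofReal (w a) * I a ∂μ).toReal := by
  have hm : Measurable fun a => ENNReal.ofReal (w a) * I a := by fun_prop
  have h1 := integrable_toReal_of_lintegral_ne_top hm.aemeasurable h
  have h2 := integral_toReal hm.aemeasurable (ae_lt_top hm h)
  simp only [ENNReal.toReal_mul, ENNReal.toReal_ofReal (hw0 _)] at h1 h2
  exact ⟨h1, h2⟩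

end Weighted

/-! ### The identity for nonnegative claims, and finiteness of its two parts. -/

section Moments

variable {Ω : Type*} [MeasurableSpace Ω] {P : Measure Ω} [IsProbabilityMeasure P]
  {L : Measure ℝ≥0} {V : ℕ → Ω → ℝ≥0∞} {X : ℕ → Ω → ℝ} {t : ℝ}

lemma lintegral_sum_sq_claims (hV : ∀ i, Measurable (V i)) (hX : ∀ i, Measurable (X i))
    (hN : IsMixedPoisson P V L) (hdep : DependsOnlyOnGap P V X) (hind : CondIndepClaims P V X)
    (ht : 0 ≤ t) :
    ∫⁻ ω, ∑ i ∈ Finset.range (claimCount V t ω), ENNReal.ofReal (X i ω ^ 2) ∂P =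
      ∫⁻ p : ℝ≥0 × ℝ, ENNReal.ofReal (p.1 * Real.exp (-(p.1 * p.2))) *
        ∫⁻ n, ThetaENN P V X (n + 1) p.2
          ∂(poissonCountLaw p.1 (t - p.2)) ∂(L.prod (volume.restrict (Set.Icc 0 t))) :=
  lintegral_sum_claims hV hX hN hdep hind ht (f := fun x => ENNReal.ofReal (x ^ 2)) (by fun_prop)

lemma measurable_lintegral_ThetaENN (t : ℝ) :
    Measurable fun p : ℝ≥0 × ℝ => ∫⁻ n, ThetaENN P V X (n + 1) p.2
      ∂(poissonCountLaw p.1 (t - p.2)) :=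
  measurable_lintegral_sum_claimLaw t (f := fun x => ENNReal.ofReal (x ^ 2)) (by fun_prop)

lemma measurable_lintegral_condPairSum (t : ℝ) {h : ℝ × ℝ → ℝ≥0∞} (hh : Measurable h) :
    Measurable fun p : ℝ≥0 × ℝ × ℝ => ∫⁻ n, condPairSum P V X h (n + 2) p.2.1 p.2.2
      ∂(poissonCountLaw p.1 (t - p.2.1 - p.2.2)) :=
  measurable_lintegral_sum_claimLaw_prod t hh

theorem lintegral_sq_aggregateClaim (hV : ∀ i, Measurable (V i)) (hX : ∀ i, Measurable (X i))
    (hN : IsMixedPoisson P V L) (hdep : DependsOnlyOnGap P V X) (hind : CondIndepClaims P V X)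
    (ht : 0 ≤ t) (hX0 : ∀ i, ∀ᵐ ω ∂P, 0 ≤ X i ω) :
    ∫⁻ ω, ENNReal.ofReal (aggregateClaim V X t ω ^ 2) ∂P =
        (∫⁻ r : ℝ≥0, (∫⁻ v in Set.Icc (0 : ℝ) t,
          ENNReal.ofReal (r * Real.exp (-(r * v))) *
            ∫⁻ n, ThetaENN P V X (n + 1) v
              ∂(poissonCountLaw r (t - v))) ∂L) +
        ∫⁻ r : ℝ≥0, (∫⁻ y in Set.Icc (0 : ℝ) t, ∫⁻ v in Set.Icc (0 : ℝ) (t - y),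
          ENNReal.ofReal ((r : ℝ) ^ 2 * Real.exp (-(r * (y + v)))) *
            ∫⁻ n, UpsilonENN P V X (n + 2) y v
              ∂(poissonCountLaw r (t - y - v))) ∂L := by
  have hsplit : ∫⁻ ω, ENNReal.ofReal (aggregateClaim V X t ω ^ 2) ∂P =
      ∫⁻ ω, ((∑ i ∈ Finset.range (claimCount V t ω), ENNReal.ofReal (X i ω ^ 2)) +
        ∑ i ∈ Finset.range (claimCount V t ω), ∑ j ∈ (Finset.range (claimCount V t ω)).erase i,
          ENNReal.ofReal (X i ω) * ENNReal.ofReal (X j ω)) ∂P := by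
    refine lintegral_congr_ae ?_
    filter_upwards [ae_all_iff.2 hX0] with ω hω
    simp only [aggregateClaim]
    rw [ofReal_sq_sum hω]
    simp only [ENNReal.ofReal_mul (hω _)]
  have hm1 : Measurable fun ω =>
      ∑ i ∈ Finset.range (claimCount V t ω), ENNReal.ofReal (X i ω ^ 2) :=
    measurable_comp_claimCount hV t
      (F := fun n ω => ∑ i ∈ Finset.range n, ENNReal.ofReal (X i ω ^ 2)) fun n => by fun_prop
  have hh : Measurable fun x : ℝ × ℝ => ENNReal.ofReal x.1 * ENNReal.ofReal x.2 := by fun_prop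
  have hpair := lintegral_sum_claims_pair hV hX hN hdep hind ht hh
  have hmR : Measurable fun p : ℝ≥0 × ℝ × ℝ =>
      ENNReal.ofReal ((p.1 : ℝ) ^ 2 * Real.exp (-(p.1 * (p.2.1 + p.2.2)))) *
        ∫⁻ n, condPairSum P V X (fun x => ENNReal.ofReal x.1 * ENNReal.ofReal x.2) (n + 2)
          p.2.1 p.2.2 ∂(poissonCountLaw p.1 (t - p.2.1 - p.2.2)) :=
    Measurable.mul (by fun_prop) (measurable_lintegral_condPairSum t hh)
  rw [hsplit, lintegral_add_left hm1, lintegral_sum_sq_claims hV hX hN hdep hind ht, hpair]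
  congr 1
  · exact lintegral_prod _
      (Measurable.mul (by fun_prop) (measurable_lintegral_ThetaENN t)).aemeasurable
  · refine (lintegral_prod _ hmR.aemeasurable).trans (lintegral_congr fun r => ?_)
    rw [setLIntegral_timeTriangle t
      (f := fun q => ENNReal.ofReal ((r : ℝ) ^ 2 * Real.exp (-(r * (q.1 + q.2)))) *
        ∫⁻ n, condPairSum P V X (fun x => ENNReal.ofReal x.1 * ENNReal.ofReal x.2) (n + 2)
          q.1 q.2 ∂(poissonCountLaw r (t - q.1 - q.2)))
      (hmR.comp (measurable_prodMk_left (x := r)))]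
    simp only [condPairSum_mul]

omit [IsProbabilityMeasure P] in
-- Applied to `|X i|`, the expansion of the square has only nonnegative terms, so finiteness of the
-- whole bounds both parts.
lemma lintegral_parts_ne_top (hV : ∀ i, Measurable (V i)) (hX : ∀ i, Measurable (X i))
    (h : ∫⁻ ω, ENNReal.ofReal (aggregateClaim V (fun i ω => |X i ω|) t ω ^ 2) ∂P < ∞) :
    ∫⁻ ω, ∑ i ∈ Finset.range (claimCount V t ω), ENNReal.ofReal (X i ω ^ 2) ∂P ≠ ∞ ∧
    ∫⁻ ω, ∑ i ∈ Finset.range (claimCount V t ω), ∑ j ∈ (Finset.range (claimCount V t ω)).erase i,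
      ENNReal.ofReal |X i ω * X j ω| ∂P ≠ ∞ := by
  have hm1 : Measurable fun ω =>
      ∑ i ∈ Finset.range (claimCount V t ω), ENNReal.ofReal (X i ω ^ 2) :=
    measurable_comp_claimCount hV t
      (F := fun n ω => ∑ i ∈ Finset.range n, ENNReal.ofReal (X i ω ^ 2)) fun n => by fun_prop
  have hsplit : ∫⁻ ω, ENNReal.ofReal (aggregateClaim V (fun i ω => |X i ω|) t ω ^ 2) ∂P =
      ∫⁻ ω, ((∑ i ∈ Finset.range (claimCount V t ω), ENNReal.ofReal (X i ω ^ 2)) +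
        ∑ i ∈ Finset.range (claimCount V t ω), ∑ j ∈ (Finset.range (claimCount V t ω)).erase i,
          ENNReal.ofReal |X i ω * X j ω|) ∂P := by
    refine lintegral_congr fun ω => ?_
    simp only [aggregateClaim]
    rw [ofReal_sq_sum fun i => abs_nonneg _]
    simp only [abs_mul, sq_abs]
  rw [hsplit, lintegral_add_left hm1] at h
  exact ENNReal.add_ne_top.1 h.ne

end Moments

/-! ### Claims of arbitrary sign. -/

section Signed

variable {Ω : Type*} [MeasurableSpace Ω] {P : Measure Ω} [IsProbabilityMeasure P]
  {L : Measure ℝ≥0} {V : ℕ → Ω → ℝ≥0∞} {X : ℕ → Ω → ℝ} {t : ℝ}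

omit [IsProbabilityMeasure P] in
lemma integral_sum_sq_claims_eq_toReal (hV : ∀ i, Measurable (V i)) (hX : ∀ i, Measurable (X i))
    (h : ∫⁻ ω, ∑ i ∈ Finset.range (claimCount V t ω), ENNReal.ofReal (X i ω ^ 2) ∂P ≠ ∞) :
    Integrable (fun ω => ∑ i ∈ Finset.range (claimCount V t ω), X i ω ^ 2) P ∧
    ∫ ω, ∑ i ∈ Finset.range (claimCount V t ω), X i ω ^ 2 ∂P =
      (∫⁻ ω, ∑ i ∈ Finset.range (claimCount V t ω), ENNReal.ofReal (X i ω ^ 2) ∂P).toReal := by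
  have hm : Measurable fun ω =>
      ∑ i ∈ Finset.range (claimCount V t ω), ENNReal.ofReal (X i ω ^ 2) :=
    measurable_comp_claimCount hV t
      (F := fun n ω => ∑ i ∈ Finset.range n, ENNReal.ofReal (X i ω ^ 2)) fun n => by fun_prop
  have heq : ∀ ω, (∑ i ∈ Finset.range (claimCount V t ω), ENNReal.ofReal (X i ω ^ 2)).toReal =
      ∑ i ∈ Finset.range (claimCount V t ω), X i ω ^ 2 := fun ω => by
    rw [ENNReal.toReal_sum fun i _ => ENNReal.ofReal_ne_top]
    exact Finset.sum_congr rfl fun i _ => ENNReal.toReal_ofReal (sq_nonneg _)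
  have h1 := integrable_toReal_of_lintegral_ne_top hm.aemeasurable h
  have h2 := integral_toReal hm.aemeasurable (ae_lt_top hm h)
  simp only [heq] at h1 h2
  exact ⟨h1, h2⟩

omit [IsProbabilityMeasure P] in
lemma integral_sum_claims_pair_eq_toReal_sub (hV : ∀ i, Measurable (V i))
    (hX : ∀ i, Measurable (X i))
    (h : ∫⁻ ω, ∑ i ∈ Finset.range (claimCount V t ω),
      ∑ j ∈ (Finset.range (claimCount V t ω)).erase i, ENNReal.ofReal |X i ω * X j ω| ∂P ≠ ∞) :
    Integrable (fun ω => ∑ i ∈ Finset.range (claimCount V t ω),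
      ∑ j ∈ (Finset.range (claimCount V t ω)).erase i, X i ω * X j ω) P ∧
    ∫ ω, ∑ i ∈ Finset.range (claimCount V t ω),
      ∑ j ∈ (Finset.range (claimCount V t ω)).erase i, X i ω * X j ω ∂P =
      (∫⁻ ω, ∑ i ∈ Finset.range (claimCount V t ω),
        ∑ j ∈ (Finset.range (claimCount V t ω)).erase i,
          ENNReal.ofReal (X i ω * X j ω) ∂P).toReal -
      (∫⁻ ω, ∑ i ∈ Finset.range (claimCount V t ω),
        ∑ j ∈ (Finset.range (claimCount V t ω)).erase i,
          ENNReal.ofReal (-(X i ω * X j ω)) ∂P).toReal := by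
  -- `g` will be the identity and the negation, so that `ENNReal.ofReal ∘ g` gives the positive and
  -- the negative part.
  have hpart : ∀ g : ℝ → ℝ, Measurable g → (∀ a, g a ≤ |a|) →
      Integrable (fun ω => ∑ i ∈ Finset.range (claimCount V t ω),
        ∑ j ∈ (Finset.range (claimCount V t ω)).erase i,
          (ENNReal.ofReal (g (X i ω * X j ω))).toReal) P ∧
      ∫ ω, ∑ i ∈ Finset.range (claimCount V t ω),
        ∑ j ∈ (Finset.range (claimCount V t ω)).erase i,
          (ENNReal.ofReal (g (X i ω * X j ω))).toReal ∂P =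
        (∫⁻ ω, ∑ i ∈ Finset.range (claimCount V t ω),
          ∑ j ∈ (Finset.range (claimCount V t ω)).erase i,
          ENNReal.ofReal (g (X i ω * X j ω)) ∂P).toReal := by
    intro g hg hle
    have hm : Measurable fun ω => ∑ i ∈ Finset.range (claimCount V t ω),
        ∑ j ∈ (Finset.range (claimCount V t ω)).erase i, ENNReal.ofReal (g (X i ω * X j ω)) :=
      measurable_comp_claimCount hV t
        (F := fun n ω => ∑ i ∈ Finset.range n, ∑ j ∈ (Finset.range n).erase i,
          ENNReal.ofReal (g (X i ω * X j ω))) fun n => by fun_prop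
    have hfin : ∫⁻ ω, ∑ i ∈ Finset.range (claimCount V t ω),
        ∑ j ∈ (Finset.range (claimCount V t ω)).erase i,
          ENNReal.ofReal (g (X i ω * X j ω)) ∂P ≠ ∞ :=
      ne_top_of_le_ne_top h (lintegral_mono fun ω => Finset.sum_le_sum fun i _ =>
        Finset.sum_le_sum fun j _ => ENNReal.ofReal_le_ofReal (hle _))
    have heq : ∀ ω, (∑ i ∈ Finset.range (claimCount V t ω),
        ∑ j ∈ (Finset.range (claimCount V t ω)).erase i,
          ENNReal.ofReal (g (X i ω * X j ω))).toReal =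
        ∑ i ∈ Finset.range (claimCount V t ω),
        ∑ j ∈ (Finset.range (claimCount V t ω)).erase i,
          (ENNReal.ofReal (g (X i ω * X j ω))).toReal := fun ω => by
      rw [ENNReal.toReal_sum fun i _ => ENNReal.sum_ne_top.2 fun j _ => ENNReal.ofReal_ne_top]
      exact Finset.sum_congr rfl fun i _ => ENNReal.toReal_sum fun j _ => ENNReal.ofReal_ne_top
    have h1 := integrable_toReal_of_lintegral_ne_top hm.aemeasurable hfin
    have h2 := integral_toReal hm.aemeasurable (ae_lt_top hm hfin)
    simp only [heq] at h1 h2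
    exact ⟨h1, h2⟩
  have hp := hpart (fun a => a) measurable_id le_abs_self
  have hn := hpart (fun a => -a) measurable_neg neg_le_abs
  have heq : ∀ ω, (∑ i ∈ Finset.range (claimCount V t ω),
      ∑ j ∈ (Finset.range (claimCount V t ω)).erase i, X i ω * X j ω) =
      (∑ i ∈ Finset.range (claimCount V t ω), ∑ j ∈ (Finset.range (claimCount V t ω)).erase i,
          (ENNReal.ofReal (X i ω * X j ω)).toReal) -
      ∑ i ∈ Finset.range (claimCount V t ω), ∑ j ∈ (Finset.range (claimCount V t ω)).erase i,
          (ENNReal.ofReal (-(X i ω * X j ω))).toReal := by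
    intro ω
    rw [← Finset.sum_sub_distrib]
    refine Finset.sum_congr rfl fun i _ => ?_
    rw [← Finset.sum_sub_distrib]
    refine Finset.sum_congr rfl fun j _ => ?_
    rw [ENNReal.toReal_ofReal', ENNReal.toReal_ofReal']
    exact (max_zero_sub_max_neg_zero_eq_self _).symm
  simp only [heq]
  exact ⟨hp.1.sub hn.1, by rw [integral_sub hp.1 hn.1, hp.2, hn.2]⟩

/-- The weight `r * exp (-(r * v))` vanishes only at rate 0; elsewhere finiteness of the weighted
integral makes the other factor finite almost everywhere. -/
lemma ae_lintegral_ThetaENN_lt_top [SFinite L] (hfin : ∫⁻ p : ℝ≥0 × ℝ,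
      ENNReal.ofReal (p.1 * Real.exp (-(p.1 * p.2))) * ∫⁻ n, ThetaENN P V X (n + 1) p.2
        ∂(poissonCountLaw p.1 (t - p.2)) ∂(L.prod (volume.restrict (Set.Icc 0 t))) ≠ ∞) :
    ∀ᵐ p : ℝ≥0 × ℝ ∂(L.prod (volume.restrict (Set.Icc 0 t))), p.1 = 0 ∨
      ∫⁻ n, ThetaENN P V X (n + 1) p.2 ∂(poissonCountLaw p.1 (t - p.2)) < ∞ := by
  filter_upwards [ae_eq_zero_or_lt_top_of_lintegral_ofReal_mul (by fun_prop)
    (measurable_lintegral_ThetaENN t) (fun p => by positivity) hfin] with p hp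
  simpa [Real.exp_ne_zero] using hp

lemma ae_lintegral_condPairSum_lt_top [SFinite L] {h : ℝ × ℝ → ℝ≥0∞} (hh : Measurable h)
    (hfin : ∫⁻ p : ℝ≥0 × ℝ × ℝ,
      ENNReal.ofReal ((p.1 : ℝ) ^ 2 * Real.exp (-(p.1 * (p.2.1 + p.2.2)))) *
        ∫⁻ n, condPairSum P V X h (n + 2) p.2.1 p.2.2
          ∂(poissonCountLaw p.1 (t - p.2.1 - p.2.2))
        ∂(L.prod (volume.restrict (timeTriangle t))) ≠ ∞) :
    ∀ᵐ p : ℝ≥0 × ℝ × ℝ ∂(L.prod (volume.restrict (timeTriangle t))), p.1 = 0 ∨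
      ∫⁻ n, condPairSum P V X h (n + 2) p.2.1 p.2.2
        ∂(poissonCountLaw p.1 (t - p.2.1 - p.2.2)) < ∞ := by
  filter_upwards [ae_eq_zero_or_lt_top_of_lintegral_ofReal_mul (by fun_prop)
    (measurable_lintegral_condPairSum t hh) (fun p => by positivity) hfin] with p hp
  simpa [Real.exp_ne_zero] using hp

theorem integral_weighted_Theta [IsProbabilityMeasure L] (ht : 0 ≤ t) (hfin : ∫⁻ p : ℝ≥0 × ℝ,
      ENNReal.ofReal (p.1 * Real.exp (-(p.1 * p.2))) * ∫⁻ n, ThetaENN P V X (n + 1) p.2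
        ∂(poissonCountLaw p.1 (t - p.2)) ∂(L.prod (volume.restrict (Set.Icc 0 t))) ≠ ∞) :
    Integrable (fun p : ℝ≥0 × ℝ => (p.1 : ℝ) * Real.exp (-(p.1 * p.2)) *
        ∫ n, Theta P V X (n + 1) p.2 ∂(poissonCountLaw p.1 (t - p.2)))
      (L.prod (volume.restrict (Set.Icc 0 t))) ∧
    ∫ r : ℝ≥0, (∫ v in (0 : ℝ)..t, (r : ℝ) * Real.exp (-(r * v)) *
        ∫ n, Theta P V X (n + 1) v ∂(poissonCountLaw r (t - v))) ∂L =
      (∫⁻ p : ℝ≥0 × ℝ,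
      ENNReal.ofReal (p.1 * Real.exp (-(p.1 * p.2))) * ∫⁻ n, ThetaENN P V X (n + 1) p.2
        ∂(poissonCountLaw p.1 (t - p.2)) ∂(L.prod (volume.restrict (Set.Icc 0 t)))).toReal := by
  have hw := integrable_mul_toReal (w := fun p : ℝ≥0 × ℝ => p.1 * Real.exp (-(p.1 * p.2)))
    (by fun_prop) (measurable_lintegral_ThetaENN t) (fun p => by positivity) hfin
  have heq : (fun p : ℝ≥0 × ℝ => (p.1 : ℝ) * Real.exp (-(p.1 * p.2)) *
      (∫⁻ n, ThetaENN P V X (n + 1) p.2 ∂(poissonCountLaw p.1 (t - p.2))).toReal)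
      =ᵐ[L.prod (volume.restrict (Set.Icc 0 t))]
      fun p => (p.1 : ℝ) * Real.exp (-(p.1 * p.2)) *
        ∫ n, Theta P V X (n + 1) p.2 ∂(poissonCountLaw p.1 (t - p.2)) := by
    filter_upwards [ae_lintegral_ThetaENN_lt_top hfin] with p hp
    -- At rate 0 no finiteness is known, but the weight is 0 and both sides vanish.
    rcases hp with hp | hp
    · simp [hp]
    · rw [(integrable_Theta hp.ne).2]
  have hint := hw.1.congr heq
  refine ⟨hint, ?_⟩
  rw [← hw.2, integral_congr_ae heq, integral_prod _ hint]
  simp only [intervalIntegral.integral_of_le ht, integral_Icc_eq_integral_Ioc]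

theorem integral_weighted_Upsilon [IsProbabilityMeasure L] (ht : 0 ≤ t)
    (hfin : ∫⁻ p : ℝ≥0 × ℝ × ℝ,
      ENNReal.ofReal ((p.1 : ℝ) ^ 2 * Real.exp (-(p.1 * (p.2.1 + p.2.2)))) *
        ∫⁻ n, condPairSum P V X (fun x => ENNReal.ofReal |x.1 * x.2|) (n + 2) p.2.1 p.2.2
          ∂(poissonCountLaw p.1 (t - p.2.1 - p.2.2))
        ∂(L.prod (volume.restrict (timeTriangle t))) ≠ ∞) :
    Integrable (fun p : ℝ≥0 × ℝ × ℝ =>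
        (p.1 : ℝ) ^ 2 * Real.exp (-(p.1 * (p.2.1 + p.2.2))) *
          ∫ n, Upsilon P V X (n + 2) p.2.1 p.2.2
            ∂(poissonCountLaw p.1 (t - p.2.1 - p.2.2)))
      (L.prod (volume.restrict (timeTriangle t))) ∧
    ∫ r : ℝ≥0, (∫ y in (0 : ℝ)..t, ∫ v in (0 : ℝ)..(t - y),
        (r : ℝ) ^ 2 * Real.exp (-(r * (y + v))) *
          ∫ n, Upsilon P V X (n + 2) y v ∂(poissonCountLaw r (t - y - v))) ∂L =
      (∫⁻ p : ℝ≥0 × ℝ × ℝ,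
        ENNReal.ofReal ((p.1 : ℝ) ^ 2 * Real.exp (-(p.1 * (p.2.1 + p.2.2)))) *
        ∫⁻ n, condPairSum P V X (fun x => ENNReal.ofReal (x.1 * x.2)) (n + 2) p.2.1 p.2.2
          ∂(poissonCountLaw p.1 (t - p.2.1 - p.2.2))
        ∂(L.prod (volume.restrict (timeTriangle t)))).toReal -
      (∫⁻ p : ℝ≥0 × ℝ × ℝ,
        ENNReal.ofReal ((p.1 : ℝ) ^ 2 * Real.exp (-(p.1 * (p.2.1 + p.2.2)))) *
        ∫⁻ n, condPairSum P V X (fun x => ENNReal.ofReal (-(x.1 * x.2))) (n + 2) p.2.1 p.2.2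
          ∂(poissonCountLaw p.1 (t - p.2.1 - p.2.2))
        ∂(L.prod (volume.restrict (timeTriangle t)))).toReal := by
  have hpart : ∀ g : ℝ × ℝ → ℝ≥0∞, Measurable g → (∀ x, g x ≤ ENNReal.ofReal |x.1 * x.2|) → _ :=
    fun g hg hle => integrable_mul_toReal
      (w := fun p : ℝ≥0 × ℝ × ℝ => (p.1 : ℝ) ^ 2 * Real.exp (-(p.1 * (p.2.1 + p.2.2))))
      (by fun_prop) (measurable_lintegral_condPairSum (P := P) (V := V) (X := X) t hg)
      (fun p => by positivity)
      (ne_top_of_le_ne_top hfin (lintegral_mono fun p => mul_le_mul_right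
        (lintegral_mono fun n => condPairSum_mono hle _ _ _) _))
  have hp := hpart _ (by fun_prop) fun x => ofReal_le_ofReal_abs (x.1 * x.2)
  have hn := hpart _ (by fun_prop) fun x => ofReal_neg_le_ofReal_abs (x.1 * x.2)
  have heq : (fun p : ℝ≥0 × ℝ × ℝ => (p.1 : ℝ) ^ 2 * Real.exp (-(p.1 * (p.2.1 + p.2.2))) *
        (∫⁻ n, condPairSum P V X (fun x => ENNReal.ofReal (x.1 * x.2)) (n + 2) p.2.1 p.2.2
          ∂(poissonCountLaw p.1 (t - p.2.1 - p.2.2))).toReal -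
        (p.1 : ℝ) ^ 2 * Real.exp (-(p.1 * (p.2.1 + p.2.2))) *
        (∫⁻ n, condPairSum P V X (fun x => ENNReal.ofReal (-(x.1 * x.2))) (n + 2) p.2.1 p.2.2
          ∂(poissonCountLaw p.1 (t - p.2.1 - p.2.2))).toReal)
      =ᵐ[L.prod (volume.restrict (timeTriangle t))]
      fun p => (p.1 : ℝ) ^ 2 * Real.exp (-(p.1 * (p.2.1 + p.2.2))) *
        ∫ n, Upsilon P V X (n + 2) p.2.1 p.2.2 ∂(poissonCountLaw p.1 (t - p.2.1 - p.2.2)) := by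
    filter_upwards [ae_lintegral_condPairSum_lt_top (by fun_prop) hfin] with p hp
    rcases hp with hp | hp
    · simp [hp]
    · rw [(integrable_Upsilon hp.ne).2, mul_sub]
  have hint := (hp.1.sub hn.1).congr heq
  refine ⟨hint, ?_⟩
  rw [← hp.2, ← hn.2, ← integral_sub hp.1 hn.1, integral_congr_ae heq, integral_prod _ hint]
  refine integral_congr_ae ?_
  -- Fubini on the triangle needs integrability of the slice, which holds for almost every rate.
  filter_upwards [hint.prod_right_ae] with r hr
  exact (setIntegral_timeTriangle ht hr).symm

end Signed

end AggregateClaims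

/-! ### Assembly of the two cases. -/

theorem mainTheorem4 {Ω : Type*} [MeasurableSpace Ω] (P : Measure Ω) [IsProbabilityMeasure P]
    (L : Measure ℝ≥0) [IsProbabilityMeasure L]
    (V : ℕ → Ω → ℝ≥0∞) (hV : ∀ i, Measurable (V i))
    (X : ℕ → Ω → ℝ) (hX : ∀ i, Measurable (X i))
    (hN : IsMixedPoisson P V L)
    (hdep : DependsOnlyOnGap P V X)
    (hind : CondIndepClaims P V X)
    (t : ℝ) (ht : 0 ≤ t) :
    -- nonnegative claim sizes: the identity holds in `[0, ∞]`
    ((∀ i, ∀ᵐ ω ∂P, 0 ≤ X i ω) →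
      ∫⁻ ω, ENNReal.ofReal (aggregateClaim V X t ω ^ 2) ∂P =
        (∫⁻ r : ℝ≥0, (∫⁻ v in Set.Icc (0 : ℝ) t,
          ENNReal.ofReal (r * Real.exp (-(r * v))) *
            ∫⁻ n, ThetaENN P V X (n + 1) v
              ∂(poissonCountLaw r (t - v))) ∂L) +
        ∫⁻ r : ℝ≥0, (∫⁻ y in Set.Icc (0 : ℝ) t, ∫⁻ v in Set.Icc (0 : ℝ) (t - y),
          ENNReal.ofReal ((r : ℝ) ^ 2 * Real.exp (-(r * (y + v)))) *
            ∫⁻ n, UpsilonENN P V X (n + 2) y v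
              ∂(poissonCountLaw r (t - y - v))) ∂L) ∧
    -- claim sizes of arbitrary sign, under absolute second moments
    (∫⁻ ω, ENNReal.ofReal
        (aggregateClaim V (fun i ω => |X i ω|) t ω ^ 2) ∂P < ∞ →
      -- all the expectations and integrals in the identity exist
      Integrable (fun ω => aggregateClaim V X t ω ^ 2) P ∧
      (∀ᵐ r : ℝ≥0 ∂L, 0 < r → ∀ᵐ v : ℝ, v ∈ Set.Ioo 0 t →
        (∀ i, Integrable (fun x : ℝ => x) (claimLaw P V X i v) ∧
          Integrable (fun x : ℝ => x ^ 2) (claimLaw P V X i v)) ∧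
        Integrable (fun n => Theta P V X (n + 1) v)
          (poissonCountLaw r (t - v))) ∧
      (∀ᵐ r : ℝ≥0 ∂L, 0 < r → ∀ᵐ y : ℝ, y ∈ Set.Ioo 0 t → ∀ᵐ v : ℝ, v ∈ Set.Ioo 0 (t - y) →
        Integrable (fun n => Upsilon P V X (n + 2) y v)
          (poissonCountLaw r (t - y - v))) ∧
      Integrable (fun p : ℝ≥0 × ℝ => (p.1 : ℝ) * Real.exp (-(p.1 * p.2)) *
          ∫ n, Theta P V X (n + 1) p.2
            ∂(poissonCountLaw p.1 (t - p.2)))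
        (L.prod (volume.restrict (Set.Icc 0 t))) ∧
      Integrable (fun p : ℝ≥0 × ℝ × ℝ =>
          (p.1 : ℝ) ^ 2 * Real.exp (-(p.1 * (p.2.1 + p.2.2))) *
            ∫ n, Upsilon P V X (n + 2) p.2.1 p.2.2
              ∂(poissonCountLaw p.1 (t - p.2.1 - p.2.2)))
        (L.prod (volume.restrict {q : ℝ × ℝ | 0 ≤ q.1 ∧ 0 ≤ q.2 ∧ q.1 + q.2 ≤ t})) ∧
      -- the identity
      ∫ ω, aggregateClaim V X t ω ^ 2 ∂P =
        (∫ r : ℝ≥0, (∫ v in (0 : ℝ)..t, (r : ℝ) * Real.exp (-(r * v)) *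
          ∫ n, Theta P V X (n + 1) v
            ∂(poissonCountLaw r (t - v))) ∂L) +
        ∫ r : ℝ≥0, (∫ y in (0 : ℝ)..t, ∫ v in (0 : ℝ)..(t - y),
          (r : ℝ) ^ 2 * Real.exp (-(r * (y + v))) *
            ∫ n, Upsilon P V X (n + 2) y v
              ∂(poissonCountLaw r (t - y - v))) ∂L) := by
  refine ⟨lintegral_sq_aggregateClaim hV hX hN hdep hind ht, fun hfin => ?_⟩
  obtain ⟨hfin1, hfin2⟩ := lintegral_parts_ne_top hV hX hfin
  have hsq := lintegral_sum_sq_claims hV hX hN hdep hind ht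
  have hpair : ∀ {h : ℝ × ℝ → ℝ≥0∞}, Measurable h →
      ∫⁻ ω, ∑ i ∈ Finset.range (claimCount V t ω),
        ∑ j ∈ (Finset.range (claimCount V t ω)).erase i, h (X i ω, X j ω) ∂P =
      ∫⁻ p : ℝ≥0 × ℝ × ℝ,
        ENNReal.ofReal ((p.1 : ℝ) ^ 2 * Real.exp (-(p.1 * (p.2.1 + p.2.2)))) *
        ∫⁻ n, condPairSum P V X h (n + 2) p.2.1 p.2.2
          ∂(poissonCountLaw p.1 (t - p.2.1 - p.2.2))
        ∂(L.prod (volume.restrict (timeTriangle t))) := fun hh =>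
    lintegral_sum_claims_pair hV hX hN hdep hind ht hh
  have habs := hpair (h := fun x => ENNReal.ofReal |x.1 * x.2|) (by fun_prop)
  obtain ⟨hD, hDeq⟩ := integral_sum_sq_claims_eq_toReal hV hX hfin1
  obtain ⟨hO, hOeq⟩ := integral_sum_claims_pair_eq_toReal_sub hV hX hfin2
  rw [hsq] at hfin1 hDeq
  rw [habs] at hfin2
  rw [hpair (h := fun x => ENNReal.ofReal (x.1 * x.2)) (by fun_prop),
    hpair (h := fun x => ENNReal.ofReal (-(x.1 * x.2))) (by fun_prop)] at hOeq
  obtain ⟨hT, hTeq⟩ := integral_weighted_Theta ht hfin1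
  obtain ⟨hU, hUeq⟩ := integral_weighted_Upsilon ht hfin2
  have hS : ∀ ω, aggregateClaim V X t ω ^ 2 =
      ∑ i ∈ Finset.range (claimCount V t ω), X i ω ^ 2 +
      ∑ i ∈ Finset.range (claimCount V t ω), ∑ j ∈ (Finset.range (claimCount V t ω)).erase i,
        X i ω * X j ω := fun ω => sq_sum_eq_sum_sq_add_sum_erase _ _
  refine ⟨?_, ?_, ?_, hT, hU, ?_⟩
  · simp only [hS]
    exact hD.add hO
  · filter_upwards [Measure.ae_ae_of_ae_prod (ae_lintegral_ThetaENN_lt_top hfin1)] with r hr hr0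
    filter_upwards [(ae_restrict_iff' measurableSet_Icc).1 hr] with v hv hvt
    have hlt := (hv (Set.Ioo_subset_Icc_self hvt)).resolve_left hr0.ne'
    -- Strictness of `v < t` makes the remaining time positive, so that every Poisson tail is
    -- positive and every single claim is controlled.
    exact ⟨fun i => integrable_claimLaw_of_condSecondENN_ne_top
      (condSecondENN_ne_top hr0 (sub_pos.2 hvt.2) hlt.ne i), (integrable_Theta hlt.ne).1⟩
  · filter_upwards [Measure.ae_ae_of_ae_prod
      (ae_lintegral_condPairSum_lt_top (by fun_prop) hfin2)] with r hr hr0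
    have hr' := (ae_restrict_iff' (measurableSet_timeTriangle t)).1 hr
    -- The exceptional null set in the plane is sliced into null sets in `v` for almost every `y`.
    rw [Measure.volume_eq_prod] at hr'
    filter_upwards [Measure.ae_ae_of_ae_prod hr'] with y hy hyt
    filter_upwards [hy] with v hv hvt
    exact (integrable_Upsilon ((hv (mem_timeTriangle.2 ⟨Set.Ioo_subset_Icc_self hyt,
      Set.Ioo_subset_Icc_self hvt⟩)).resolve_left hr0.ne').ne).1
  · simp only [hS]
    rw [integral_add hD hO, hDeq, hOeq, hTeq, hUeq]
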